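/- For $\varepsilon>0$ let $\mathcal M_{\rm a}^{\varepsilon,+}$ be the set of all measures $\mu=\sum_{n\in J}\beta_n\delta_{t_n}$ on $\mathbb R$, with $J$ finite, infinite or empty, such that $\beta_n\in[1,\infty)$ for all $n$, $|t_n-t_m|\ge\varepsilon$ for all $n\ne m$, and $\operatorname{supp}\mu\subset[\varepsilon,\infty)$. For such $\mu$ define $b_n\in(1,\infty]$ by $\beta_n=(\sqrt{b_n}+1)/(\sqrt{b_n}-1)$, where $b_n=\infty$ if $\beta_n=1$, and let $A^+_\mu$ be the operator in the complex Hilbert space $L^2(0,\infty)$ acting as $A^+_\mu f=-f''$ on $(0,\infty)\setminus\operatorname{supp}\mu$, whose domain consists of all $f\in H^2\big((0,\infty)\setminus\operatorname{supp}\mu\big)$ with $f(0)=0$ and $$f(t_n+)=\sqrt{b_n}\,f(t_n-),\qquad f'(t_n+)=\frac{1}{\sqrt{b_n}}\,f'(t_n-)\qquad\text{for all } n\in J,$$ which for $b_n=\infty$ is read as $f(t_n-)=0$ and $f'(t_n+)=0$. Proposition. Let $\varepsilon>0$, let $\mu^{(j)}\in\mathcal M_{\rm a}^{\varepsilon,+}$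 for $j=1,2,\dots$, and let $\mu$ be a locally finite Borel measure on $\mathbb R$ such that $\mu^{(j)}\to\mu$ weakly, that is, $\int\varphi\,d\mu^{(j)}\to\int\varphi\,d\mu$ for every continuous compactly supported $\varphi:\mathbb R\to\mathbb R$. Then $\mu\in\mathcal M_{\rm a}^{\varepsilon,+}$, and $A^+_{\mu^{(j)}}\to A^+_\mu$ in the strong resolvent sense: the operators $A^+_{\mu^{(j)}}$ and $A^+_\mu$ are self-adjoint, and for every $z\in\mathbb C\setminus\mathbb R$ and every $f\in L^2(0,\infty)$ one has $(A^+_{\mu^{(j)}}-z)^{-1}f\to(A^+_\mu-z)^{-1}f$ in $L^2(0,\infty)$. -/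

import Mathlib

open MeasureTheory Filter Topology Set

noncomputable section

namespace HalfLine

/-! ### The classes of measures -/

/-- The non-negative atomic measures `∑ β_t δ_t` on `ℝ`, with weights `β_t ∈ [1, ∞)` and with a
set `S` of atoms (finite, infinite or empty) in which distinct points are at distance at least
`ε`. -/
def AtomicMeasures (ε : ℝ) : Set (Measure ℝ) :=
  {μ | ∃ (S : Set ℝ) (β : ℝ → ℝ),
      (∀ t ∈ S, 1 ≤ β t) ∧ (∀ s ∈ S, ∀ t ∈ S, s ≠ t → ε ≤ |s - t|) ∧
      μ = Measure.sum fun t : S => ENNReal.ofReal (β t) • Measure.dirac (t : ℝ)}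

/-- The measures in `AtomicMeasures ε` whose support lies in `[ε, ∞)`. -/
def AtomicMeasuresPos (ε : ℝ) : Set (Measure ℝ) :=
  {μ | μ ∈ AtomicMeasures ε ∧ μ.support ⊆ Ici ε}

/-- Weak convergence of Borel measures on `ℝ`, tested on continuous functions of compact
support. -/
def WeaklyConverges (μs : ℕ → Measure ℝ) (μ : Measure ℝ) : Prop :=
  ∀ φ : ℝ → ℝ, Continuous φ → HasCompactSupport φ →
    Tendsto (fun j => ∫ t, φ t ∂(μs j)) atTop (𝓝 (∫ t, φ t ∂μ))

/-! ### The operator attached to a measure -/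

/-- The complex Hilbert space `L²(0, ∞)`. -/
abbrev L2Half : Type := Lp ℂ 2 ((volume : Measure ℝ).restrict (Ioi 0))

/-- `g` is the derivative of the locally absolutely continuous function `f` on `U`: on each
compact interval inside `U`, `g` is integrable and `f` is an indefinite integral of `g`. -/
def IsDerivOn (U : Set ℝ) (f g : ℝ → ℂ) : Prop :=
  ∀ a b : ℝ, a ≤ b → Icc a b ⊆ U →
    IntervalIntegrable g volume a b ∧ f b - f a = ∫ x in a..b, g x

/-- `f` is in the Sobolev space `H²(U)`, `U ⊆ ℝ` open, with `f` and `f₁` the continuous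
representatives on `U` of the function and of its first derivative, and with second
derivative `f₂`. -/
structure IsH2On (U : Set ℝ) (f f₁ f₂ : ℝ → ℂ) : Prop where
  memLp : MemLp f 2 (volume.restrict U)
  memLp_deriv : MemLp f₁ 2 (volume.restrict U)
  memLp_deriv2 : MemLp f₂ 2 (volume.restrict U)
  deriv : IsDerivOn U f f₁
  deriv2 : IsDerivOn U f₁ f₂

/-- The number `b ∈ (1, ∞)` with `β = (√b + 1) / (√b - 1)`, for `β > 1`; the value `β = 1`
stands for `b = ∞`. -/
def branching (β : ℝ) : ℝ := ((β + 1) / (β - 1)) ^ 2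

lemma branching_spec {β : ℝ} (hβ : 1 < β) :
    1 < branching β ∧ (√(branching β) + 1) / (√(branching β) - 1) = β := by
  have h0 : 0 < β - 1 := by linarith
  have h1 : 1 < (β + 1) / (β - 1) := by rw [lt_div_iff₀ h0]; linarith
  have h2 : √(branching β) = (β + 1) / (β - 1) := Real.sqrt_sq (by linarith)
  refine ⟨one_lt_pow₀ h1 two_ne_zero, ?_⟩
  rw [h2]
  have h3 : (β + 1) / (β - 1) - 1 ≠ 0 := by linarith
  rw [div_eq_iff h3]
  field_simp
  ring

/-- The one-sided limits `f(t±)` and `f₁(t±)` exist and satisfy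
`f(t+) = √b f(t-)` and `f₁(t+) = f₁(t-) / √b`, where `β = (√b + 1) / (√b - 1)`; for `β = 1`, that
is `b = ∞`, this is read as `f(t-) = 0` and `f₁(t+) = 0`. -/
def JumpCondition (β t : ℝ) (f f₁ : ℝ → ℂ) : Prop :=
  ∃ fm fp dm dp : ℂ,
    Tendsto f (𝓝[<] t) (𝓝 fm) ∧ Tendsto f (𝓝[>] t) (𝓝 fp) ∧
    Tendsto f₁ (𝓝[<] t) (𝓝 dm) ∧ Tendsto f₁ (𝓝[>] t) (𝓝 dp) ∧
    (β ≠ 1 → fp = (√(branching β) : ℂ) * fm ∧ dp = 1 / (√(branching β) : ℂ) * dm) ∧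
    (β = 1 → fm = 0 ∧ dp = 0)

/-- The open set `(0, ∞) \ supp μ`. -/
def regularSet (μ : Measure ℝ) : Set ℝ := Ioi 0 \ μ.support

/-- `v = -u''` for a function `u` in the domain of the operator attached to `μ`: on
`(0, ∞) \ supp μ` the function `u` is in `H²` with `v = -u''`, `u(0+) = 0`, and the jump condition
with `β = μ {t}` holds at each point `t` of `supp μ`. -/
def IsOperatorPair (μ : Measure ℝ) (u v : L2Half) : Prop :=
  ∃ f f₁ f₂ : ℝ → ℂ,
    u =ᵐ[volume.restrict (Ioi 0)] f ∧ v =ᵐ[volume.restrict (Ioi 0)] (fun t => -f₂ t) ∧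
    IsH2On (regularSet μ) f f₁ f₂ ∧
    Tendsto f (𝓝[>] 0) (𝓝 0) ∧
    ∀ t ∈ μ.support, JumpCondition (μ.real {t}) t f f₁

lemma IsDerivOn.add {U : Set ℝ} {f g f' g' : ℝ → ℂ} (h : IsDerivOn U f g)
    (h' : IsDerivOn U f' g') : IsDerivOn U (f + f') (g + g') := by
  intro a b hab hU
  obtain ⟨h1, h2⟩ := h a b hab hU
  obtain ⟨h3, h4⟩ := h' a b hab hU
  refine ⟨h1.add h3, ?_⟩
  simp only [Pi.add_apply]
  rw [intervalIntegral.integral_add h1 h3, ← h2, ← h4]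
  ring

lemma IsDerivOn.smul {U : Set ℝ} {f g : ℝ → ℂ} (c : ℂ) (h : IsDerivOn U f g) :
    IsDerivOn U (c • f) (c • g) := by
  intro a b hab hU
  obtain ⟨h1, h2⟩ := h a b hab hU
  refine ⟨h1.smul c, ?_⟩
  simp only [Pi.smul_apply]
  rw [intervalIntegral.integral_smul, ← h2, smul_sub]

lemma JumpCondition.add {β t : ℝ} {f f₁ g g₁ : ℝ → ℂ} (h : JumpCondition β t f f₁)
    (h' : JumpCondition β t g g₁) : JumpCondition β t (f + g) (f₁ + g₁) := by
  obtain ⟨a, b, c, d, h1, h2, h3, h4, h5, h6⟩ := h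
  obtain ⟨a', b', c', d', k1, k2, k3, k4, k5, k6⟩ := h'
  refine ⟨a + a', b + b', c + c', d + d', h1.add k1, h2.add k2, h3.add k3, h4.add k4, ?_, ?_⟩
  · intro hb
    rw [(h5 hb).1, (h5 hb).2, (k5 hb).1, (k5 hb).2]
    constructor <;> ring
  · intro hb
    rw [(h6 hb).1, (h6 hb).2, (k6 hb).1, (k6 hb).2]
    simp

lemma JumpCondition.smul {β t : ℝ} {f f₁ : ℝ → ℂ} (r : ℂ) (h : JumpCondition β t f f₁) :
    JumpCondition β t (r • f) (r • f₁) := by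
  obtain ⟨a, b, c, d, h1, h2, h3, h4, h5, h6⟩ := h
  refine ⟨r • a, r • b, r • c, r • d, h1.const_smul r, h2.const_smul r, h3.const_smul r,
    h4.const_smul r, ?_, ?_⟩
  · intro hb
    rw [(h5 hb).1, (h5 hb).2]
    simp only [smul_eq_mul]
    constructor <;> ring
  · intro hb
    rw [(h6 hb).1, (h6 hb).2]
    simp

/-- The graph of the operator attached to `μ`. -/
def operatorGraph (μ : Measure ℝ) : Submodule ℂ (L2Half × L2Half) where
  carrier := {p | IsOperatorPair μ p.1 p.2}
  zero_mem' := by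
    refine ⟨0, 0, 0, Lp.coeFn_zero _ _ _, ?_, ?_, tendsto_const_nhds, ?_⟩
    · filter_upwards [Lp.coeFn_zero ℂ 2 ((volume : Measure ℝ).restrict (Ioi 0))] with x hx
      simpa using hx
    · exact ⟨MemLp.zero, MemLp.zero, MemLp.zero,
        fun a b _ _ => ⟨intervalIntegrable_const (c := (0 : ℂ)), by simp⟩,
        fun a b _ _ => ⟨intervalIntegrable_const (c := (0 : ℂ)), by simp⟩⟩
    · intro t _
      exact ⟨0, 0, 0, 0, tendsto_const_nhds, tendsto_const_nhds, tendsto_const_nhds,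
        tendsto_const_nhds, by simp, by simp⟩
  add_mem' := by
    rintro ⟨u, v⟩ ⟨u', v'⟩ ⟨f, f₁, f₂, h1, h2, h3, h4, h5⟩ ⟨g, g₁, g₂, k1, k2, k3, k4, k5⟩
    refine ⟨f + g, f₁ + g₁, f₂ + g₂, ?_, ?_, ?_, ?_, fun t ht => (h5 t ht).add (k5 t ht)⟩
    · filter_upwards [h1, k1, Lp.coeFn_add u u'] with x a b c
      simp_all
    · filter_upwards [h2, k2, Lp.coeFn_add v v'] with x a b c
      simp_all
      ring
    · exact ⟨h3.memLp.add k3.memLp, h3.memLp_deriv.add k3.memLp_deriv,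
        h3.memLp_deriv2.add k3.memLp_deriv2, h3.deriv.add k3.deriv, h3.deriv2.add k3.deriv2⟩
    · rw [← add_zero (0 : ℂ)]
      exact h4.add k4
  smul_mem' := by
    rintro c ⟨u, v⟩ ⟨f, f₁, f₂, h1, h2, h3, h4, h5⟩
    refine ⟨c • f, c • f₁, c • f₂, ?_, ?_, ?_, ?_, fun t ht => (h5 t ht).smul c⟩
    · filter_upwards [h1, Lp.coeFn_smul c u] with x a b
      simp_all
    · filter_upwards [h2, Lp.coeFn_smul c v] with x a b
      simp_all
    · exact ⟨h3.memLp.const_smul c, h3.memLp_deriv.const_smul c,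
        h3.memLp_deriv2.const_smul c, h3.deriv.smul c, h3.deriv2.smul c⟩
    · have := h4.const_smul c
      rwa [smul_zero] at this

/-- The operator `A⁺_μ` in `L²(0, ∞)`: `u ↦ -u''` on `(0, ∞) \ supp μ`, with `u(0) = 0` and with
the jump conditions on `supp μ`. -/
def halfLineOperator (μ : Measure ℝ) : L2Half →ₗ.[ℂ] L2Half :=
  (operatorGraph μ).toLinearPMap

/-! ### The operator is well defined: its graph is `operatorGraph μ` -/

lemma IsDerivOn.continuousOn {U : Set ℝ} (hU : IsOpen U) {f g : ℝ → ℂ} (h : IsDerivOn U f g) :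
    ContinuousOn f U := by
  intro x hx
  obtain ⟨r, hr, hrU⟩ := Metric.nhds_basis_closedBall.mem_iff.1 (hU.mem_nhds hx)
  rw [Real.closedBall_eq_Icc] at hrU
  have hi := (h (x - r) (x + r) (by linarith) hrU).1
  have hc := intervalIntegral.continuousOn_primitive_interval' hi
    (a := x - r) (by simp)
  rw [uIcc_of_le (by linarith)] at hc
  have hc' : ContinuousOn f (Icc (x - r) (x + r)) := by
    refine (hc.const_add (f (x - r))).congr fun y hy => ?_
    have := (h (x - r) y hy.1 ((Icc_subset_Icc_right hy.2).trans hrU)).2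
    simp only [← this]
    ring
  exact (hc'.continuousAt (Icc_mem_nhds (by linarith) (by linarith))).continuousWithinAt

lemma IsDerivOn.ae_eq_zero {U : Set ℝ} (hU : IsOpen U) {f g : ℝ → ℂ} (h : IsDerivOn U f g)
    (hf : ∀ x ∈ U, f x = 0) : g =ᵐ[volume.restrict U] 0 := by
  rw [EventuallyEq, ae_restrict_iff' hU.measurableSet]
  have key : ∀ p : ℚ × ℚ, ∀ᵐ x : ℝ, x ∈ Ioo (p.1 : ℝ) p.2 → Icc (p.1 : ℝ) p.2 ⊆ U → g x = 0 := by
    rintro ⟨p, q⟩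
    by_cases hpq : (p : ℝ) ≤ q ∧ Icc (p : ℝ) q ⊆ U
    · obtain ⟨hpq, hI⟩ := hpq
      filter_upwards [(h p q hpq hI).1.ae_hasDerivAt_integral] with x hx hx1 _
      rw [uIcc_of_le hpq] at hx
      refine (hx (Ioo_subset_Icc_self hx1) p ⟨le_rfl, hpq⟩).unique ?_
      refine (hasDerivAt_const x (0 : ℂ)).congr_of_eventuallyEq ?_
      filter_upwards [Ioo_mem_nhds hx1.1 hx1.2] with y hy
      rw [← (h p y hy.1.le ((Icc_subset_Icc_right hy.2.le).trans hI)).2,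
        hf y (hI (Ioo_subset_Icc_self hy)), hf p (hI ⟨le_rfl, hpq⟩), sub_zero]
    · refine Eventually.of_forall fun x hx hI => absurd ⟨(hx.1.trans hx.2).le, hI⟩ hpq
  filter_upwards [ae_all_iff.2 key] with x hx hxU
  obtain ⟨r, hr, hrU⟩ := Metric.nhds_basis_closedBall.mem_iff.1 (hU.mem_nhds hxU)
  rw [Real.closedBall_eq_Icc] at hrU
  obtain ⟨p, hp1, hp2⟩ := exists_rat_btwn (show x - r < x by linarith)
  obtain ⟨q, hq1, hq2⟩ := exists_rat_btwn (show x < x + r by linarith)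
  exact hx (p, q) ⟨hp2, hq1⟩ ((Icc_subset_Icc hp1.le hq2.le).trans hrU)

lemma eqOn_zero_of_ae {U : Set ℝ} (hU : IsOpen U) {f : ℝ → ℂ} (hc : ContinuousOn f U)
    (hf : f =ᵐ[volume.restrict U] 0) : ∀ x ∈ U, f x = 0 := 
  Measure.eqOn_open_of_ae_eq hf hU hc continuousOn_const

lemma operatorGraph_singleValued {μ : Measure ℝ} (hμ : volume μ.support = 0) :
    ∀ p ∈ operatorGraph μ, p.1 = 0 → p.2 = 0 := by
  rintro ⟨u, v⟩ ⟨f, f₁, f₂, h1, h2, h3, -, -⟩ (rfl : u = 0)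
  have hU : IsOpen (regularSet μ) := isOpen_Ioi.sdiff μ.isClosed_support
  have hae : (volume : Measure ℝ).restrict (regularSet μ) = volume.restrict (Ioi 0) :=
    Measure.restrict_congr_set (sdiff_null_ae_eq_self hμ)
  have e0 : f =ᵐ[volume.restrict (regularSet μ)] 0 := by
    rw [hae]
    exact h1.symm.trans (Lp.coeFn_zero _ _ _)
  have e1 := h3.deriv.ae_eq_zero hU (eqOn_zero_of_ae hU (h3.deriv.continuousOn hU) e0)
  have e2 := h3.deriv2.ae_eq_zero hU (eqOn_zero_of_ae hU (h3.deriv2.continuousOn hU) e1)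
  rw [hae] at e2
  refine (Lp.eq_zero_iff_ae_eq_zero).2 ?_
  filter_upwards [h2, e2] with x a b
  simp_all

lemma countable_support {ε : ℝ} (hε : 0 < ε) {μ : Measure ℝ} (hμ : μ ∈ AtomicMeasures ε) :
    μ.support.Countable := by
  obtain ⟨S, β, -, hS, rfl⟩ := hμ
  have hclosed : IsClosed S :=
    Metric.isClosed_of_pairwise_le_dist hε fun s hs t ht hst => hS s hs t ht hst
  have : DiscreteTopology S := DiscreteTopology.of_forall_le_dist hε
    fun s t hst => hS s s.2 t t.2 fun h => hst (Subtype.ext h)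
  have hcount : S.Countable := countable_coe_iff.1 countable_of_Lindelof_of_discrete
  refine hcount.mono (Measure.support_subset_of_isClosed hclosed ?_)
  rw [mem_ae_iff, Measure.sum_apply _ hclosed.measurableSet.compl]
  simp [Measure.dirac_apply' _ hclosed.measurableSet.compl]

/-- For the measures of the theory, `halfLineOperator μ` has exactly the graph
`operatorGraph μ`. -/
theorem halfLineOperator_graph {ε : ℝ} (hε : 0 < ε) {μ : Measure ℝ}
    (hμ : μ ∈ AtomicMeasures ε) : (halfLineOperator μ).graph = operatorGraph μ :=
  Submodule.toLinearPMap_graph_eq _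
    (operatorGraph_singleValued ((countable_support hε hμ).measure_zero volume))

/-! ### Strong resolvent convergence -/

/-- The bounded operator `R` is the resolvent `(A - z)⁻¹`. -/
def IsResolvent {H : Type*} [NormedAddCommGroup H] [InnerProductSpace ℂ H]
    (A : H →ₗ.[ℂ] H) (z : ℂ) (R : H →L[ℂ] H) : Prop :=
  (∀ x : A.domain, R (A x - z • (x : H)) = x) ∧
  (∀ y : H, ∃ x : A.domain, (x : H) = R y ∧ A x - z • (x : H) = y)

/-- Strong resolvent convergence `A_j → A` of self-adjoint operators: all the operators are
self-adjoint and `(A_j - z)⁻¹ → (A - z)⁻¹` strongly for all non-real `z`. -/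
def StrongResolventConverges {H : Type*} [NormedAddCommGroup H] [InnerProductSpace ℂ H]
    [CompleteSpace H] (As : ℕ → H →ₗ.[ℂ] H) (A : H →ₗ.[ℂ] H) : Prop :=
  (∀ j, IsSelfAdjoint (As j)) ∧ IsSelfAdjoint A ∧
  ∀ z : ℂ, z.im ≠ 0 → ∃ (Rs : ℕ → H →L[ℂ] H) (R : H →L[ℂ] H),
    (∀ j, IsResolvent (As j) z (Rs j)) ∧ IsResolvent A z R ∧
    ∀ x : H, Tendsto (fun j => Rs j x) atTop (𝓝 (R x))

end HalfLine

end

/-!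
The proof replaces the second-order operator by a first-order system on the whole line. Writing the
jump condition at an atom of mass `β` as `(β - 1) f(t+) = (β + 1) f(t-)` and
`(β + 1) f'(t+) = (β - 1) f'(t-)` removes the case distinction at `β = 1`, and the boundary
condition `f(0) = 0` becomes one more condition of the same kind at the additional point `0`, which
decouples the two half-lines. The function `f` and its derivative `f'` thus satisfy two linear jump conditions
of the same type (`JumpData`, `IsFirstOrderPair`), with the two coefficients exchanged
(`JumpData.swap`).

The two conditions are adjoint to each other. On the one hand, integration by parts produces no
boundary terms (`IsFirstOrderPair.integral_eq_zero`). On the other hand, a pair in `L² ⊕ L²`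
orthogonal to all test pairs supported near a single point satisfies the exchanged conditions; this
is the lemma of du Bois-Reymond with a jump (`exists_isFirstOrderPair_of_orthogonal`). Hence the
pairs `(f, f')` form a closed subspace whose orthogonal complement is explicitly known, and the
first component of the projection of `(v, 0)` onto it solves `u - u'' = v`
(`JumpData.solve_eq_iff`). This gives `(A + 1)⁻¹` as a bounded self-adjoint operator, from which the
self-adjointness of `A` and all its resolvents follow abstractly
(`IsShiftedInverse.isSelfAdjoint`, `IsShiftedInverse.exists_isResolvent`).

Weak convergence of the measures means that the atoms and their masses converge locally: distinct
atoms cannot merge because of their separation, and no atom can fade away because its mass is at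
least `1` (`WeaklyConverges.isSeparated`, `WeaklyConverges.converges_jumpData`). A test pair of the
limit problem is then a limit of test pairs of the approximating problems, and likewise for the
adjoint conditions. These two kinds of test pairs together span a dense subspace, so the projections
converge strongly (`JumpData.Converges.tendsto_solve`), hence so do the operators `(A_j + 1)⁻¹`, and
therefore all resolvents (`strongResolventConverges_of_isShiftedInverse`).
-/

noncomputable section

namespace HalfLine

/-! ### Operators given by a bounded inverse of `A + 1` -/

section Abstract

variable {H : Type*} [NormedAddCommGroup H] [InnerProductSpace ℂ H]

/-- `R = (A + 1)⁻¹` as a relation between the bounded operator `R` and the graph of `A`: the pairs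
of the graph are exactly the `(R v, v - R v)`. -/
def IsShiftedInverse (A : H →ₗ.[ℂ] H) (R : H →L[ℂ] H) : Prop :=
  ∀ x y : H, (x, y) ∈ A.graph ↔ R (x + y) = x

lemma IsShiftedInverse.mem_graph {A : H →ₗ.[ℂ] H} {R : H →L[ℂ] H} (h : IsShiftedInverse A R)
    (v : H) : (R v, v - R v) ∈ A.graph := by
  rw [h]
  simp

lemma IsShiftedInverse.apply_domain {A : H →ₗ.[ℂ] H} {R : H →L[ℂ] H} (h : IsShiftedInverse A R)
    (x : A.domain) : R (x + A x) = x :=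
  (h _ _).1 (A.mem_graph x)

variable [CompleteSpace H]

lemma IsShiftedInverse.dense_domain {A : H →ₗ.[ℂ] H} {R : H →L[ℂ] H} (h : IsShiftedInverse A R)
    (hR : IsSelfAdjoint R) : Dense (A.domain : Set H) := by
  rw [Submodule.dense_iff_topologicalClosure_eq_top, Submodule.topologicalClosure_eq_top_iff,
    Submodule.eq_bot_iff]
  intro y hy
  have hRy : R y = 0 := by
    refine ext_inner_left ℂ fun v => ?_
    rw [inner_zero_right]
    exact (ContinuousLinearMap.isSelfAdjoint_iff_isSymmetric.1 hR v y).symm.trans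
      (hy _ (A.mem_domain_of_mem_graph (h.mem_graph v)))
  exact A.graph_fst_eq_zero_snd ((h 0 y).2 (by simpa using hRy)) rfl

/-- An operator whose shift `A + 1` has a bounded self-adjoint inverse is self-adjoint; density of
the domain comes for free. -/
theorem IsShiftedInverse.isSelfAdjoint {A : H →ₗ.[ℂ] H} {R : H →L[ℂ] H}
    (h : IsShiftedInverse A R) (hR : IsSelfAdjoint R) : IsSelfAdjoint A := by
  have hs := ContinuousLinearMap.isSelfAdjoint_iff_isSymmetric.1 hR
  rw [LinearPMap.isSelfAdjoint_def]
  apply LinearPMap.eq_of_eq_graph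
  rw [LinearPMap.adjoint_graph_eq_graph_adjoint (h.dense_domain hR)]
  ext ⟨x, y⟩
  rw [Submodule.mem_adjoint_iff, h]
  have key : ∀ v : H, inner ℂ (v - R v) x - inner ℂ (R v) y = inner ℂ v (x - R (x + y)) := by
    intro v
    have h1 : inner ℂ (R v) x = inner ℂ v (R x) := hs v x
    have h2 : inner ℂ (R v) y = inner ℂ v (R y) := hs v y
    rw [inner_sub_left, inner_sub_right, map_add, inner_add_right, h1, h2]
    ring
  constructor
  · intro hxy
    have : x - R (x + y) = 0 := by
      refine ext_inner_left ℂ fun v => ?_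
      rw [← key, inner_zero_right]
      exact hxy _ _ (h.mem_graph v)
    exact (sub_eq_zero.1 this).symm
  · intro hxy a b hab
    have hv := (h a b).1 hab
    have := key (a + b)
    rw [hv, hxy, sub_self, inner_zero_right] at this
    simpa using this

/-- The resolvent at a non-real `z` is `(1 - (z + 1) R)⁻¹ R` with `R = (A + 1)⁻¹`; the inverse
exists because the spectrum of `R` is real. -/
theorem IsShiftedInverse.exists_isResolvent {A : H →ₗ.[ℂ] H} {R : H →L[ℂ] H}
    (h : IsShiftedInverse A R) (hR : IsSelfAdjoint R) {z : ℂ} (hz : z.im ≠ 0) :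
    ∃ T : H →L[ℂ] H, IsResolvent A z T := by
  have hz1 : z + 1 ≠ 0 := fun h0 => hz (by simpa using congrArg Complex.im h0)
  have hw : (z + 1)⁻¹ ∉ spectrum ℂ R := by
    intro hmem
    have h1 := hR.mem_spectrum_eq_re hmem
    have h2 : z + 1 = (((z + 1)⁻¹.re)⁻¹ : ℝ) := by
      rw [Complex.ofReal_inv, ← h1, inv_inv]
    have h3 := congrArg Complex.im h2
    rw [Complex.ofReal_im] at h3
    exact hz (by simpa using h3)
  obtain ⟨V, hV⟩ := spectrum.notMem_iff.1 hw
  have hVapp : ∀ x : H, (V : H →L[ℂ] H) x = (z + 1)⁻¹ • x - R x := by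
    intro x
    rw [hV]
    simp [Algebra.algebraMap_eq_smul_one]
  have hinv : ∀ x : H, (↑V⁻¹ : H →L[ℂ] H) ((V : H →L[ℂ] H) x) = x := fun x =>
    congrArg (fun L : H →L[ℂ] H => L x) V.inv_mul
  have hinv' : ∀ x : H, (V : H →L[ℂ] H) ((↑V⁻¹ : H →L[ℂ] H) x) = x := fun x =>
    congrArg (fun L : H →L[ℂ] H => L x) V.mul_inv
  refine ⟨(z + 1)⁻¹ • ((↑V⁻¹ : H →L[ℂ] H) ∘L R), fun x => ?_, fun y => ?_⟩
  · have h1 : A x - z • (x : H) = (x + A x) - (z + 1) • (x : H) := by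
      rw [add_smul, one_smul]; abel
    have h2 : R (A x - z • (x : H)) = (z + 1) • (V : H →L[ℂ] H) x := by
      rw [h1, map_sub, map_smul, h.apply_domain, hVapp, smul_sub, smul_inv_smul₀ hz1]
    simp only [smul_apply, ContinuousLinearMap.comp_apply]
    rw [h2, map_smul, hinv, inv_smul_smul₀ hz1]
  · set x : H := ((z + 1)⁻¹ • ((↑V⁻¹ : H →L[ℂ] H) ∘L R)) y with hx
    have h1 : (V : H →L[ℂ] H) x = (z + 1)⁻¹ • R y := by
      rw [hx, smul_apply, ContinuousLinearMap.comp_apply, map_smul, hinv']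
    rw [hVapp] at h1
    have h2 : R (x + (y + z • x)) = x := by
      have h3 : x + (y + z • x) = y + (z + 1) • x := by rw [add_smul, one_smul]; abel
      have h4 := congrArg (fun u => (z + 1) • u) h1
      simp only [smul_sub, smul_inv_smul₀ hz1] at h4
      rw [h3, map_add, map_smul, ← h4]
      abel
    obtain ⟨x', hx', hAx'⟩ := (LinearPMap.mem_graph_iff A).1 ((h x (y + z • x)).2 h2)
    refine ⟨x', hx', ?_⟩
    rw [hAx', hx']
    simp

/-- The bound `‖(A - z)⁻¹‖ ≤ 1 / |Im z|`. -/
lemma IsShiftedInverse.norm_resolvent_le {A : H →ₗ.[ℂ] H} {R : H →L[ℂ] H}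
    (h : IsShiftedInverse A R) (hR : IsSelfAdjoint R) {z : ℂ} {T : H →L[ℂ] H}
    (hT : IsResolvent A z T) (y : H) : |z.im| * ‖T y‖ ≤ ‖y‖ := by
  obtain ⟨x, hx, hy⟩ := hT.2 y
  rw [← hx]
  have hreal : (inner ℂ (x : H) (A x)).im = 0 := by
    have h1 := h.apply_domain x
    have h2 := ContinuousLinearMap.isSelfAdjoint_iff_isSymmetric.1 hR (x + A x) (x + A x)
    simp only [ContinuousLinearMap.coe_coe, h1] at h2
    rw [inner_add_left, inner_add_right, add_right_inj, ← inner_conj_symm (A x) (x : H)] at h2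
    exact Complex.conj_eq_iff_im.1 h2.symm
  have h3 : (inner ℂ (x : H) y).im = -(z.im * ‖(x : H)‖ ^ 2) := by
    have hn : inner ℂ (x : H) (x : H) = ((‖(x : H)‖ ^ 2 : ℝ) : ℂ) := by
      rw [inner_self_eq_norm_sq_to_K]; norm_cast
    rw [← hy, inner_sub_right, inner_smul_right, Complex.sub_im, hreal, hn, Complex.im_mul_ofReal]
    ring
  have h4 : |z.im| * ‖(x : H)‖ ^ 2 ≤ ‖(x : H)‖ * ‖y‖ := by
    calc |z.im| * ‖(x : H)‖ ^ 2 = |(inner ℂ (x : H) y).im| := by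
          rw [h3, abs_neg, abs_mul, abs_of_nonneg (sq_nonneg ‖(x : H)‖)]
      _ ≤ ‖inner ℂ (x : H) y‖ := Complex.abs_im_le_norm _
      _ ≤ ‖(x : H)‖ * ‖y‖ := norm_inner_le_norm _ _
  rcases (norm_nonneg (x : H)).eq_or_lt with h0 | h0
  · rw [← h0, mul_zero]
    exact norm_nonneg y
  · nlinarith

/-- Strong convergence of the inverses `(A_j + 1)⁻¹` implies strong resolvent convergence. -/
theorem strongResolventConverges_of_isShiftedInverse {As : ℕ → H →ₗ.[ℂ] H} {A : H →ₗ.[ℂ] H}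
    {Rs : ℕ → H →L[ℂ] H} {R : H →L[ℂ] H} (hRs : ∀ j, IsSelfAdjoint (Rs j)) (hR : IsSelfAdjoint R)
    (hAs : ∀ j, IsShiftedInverse (As j) (Rs j)) (hA : IsShiftedInverse A R)
    (hlim : ∀ x, Tendsto (fun j => Rs j x) atTop (𝓝 (R x))) : StrongResolventConverges As A := by
  refine ⟨fun j => (hAs j).isSelfAdjoint (hRs j), hA.isSelfAdjoint hR, fun z hz => ?_⟩
  choose Ts hTs using fun j => (hAs j).exists_isResolvent (hRs j) hz
  obtain ⟨T, hT⟩ := hA.exists_isResolvent hR hz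
  refine ⟨Ts, T, hTs, hT, fun y => ?_⟩
  obtain ⟨w, hw, hy⟩ := hT.2 y
  rw [← hw]
  -- `R_j v` with `v = (A + 1) w` lies in the domain of `A_j`, tends to `w`, and is mapped by
  -- `A_j - z` to a sequence tending to `y`
  set v : H := w + A w with hv
  have hwj : Tendsto (fun j => Rs j v) atTop (𝓝 (w : H)) := by
    have := hlim v
    rwa [hA.apply_domain w] at this
  have hbound : ∀ j, ‖Ts j y - Rs j v‖ ≤ |z.im|⁻¹ * (‖z + 1‖ * ‖Rs j v - w‖) := by
    intro j
    obtain ⟨x, hx, hAx⟩ := (LinearPMap.mem_graph_iff _).1 ((hAs j).mem_graph v)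
    simp only at hx hAx
    have h1 := (hTs j).1 x
    rw [hAx, hx] at h1
    have h2 : Ts j y - Rs j v = Ts j ((z + 1) • (Rs j v - w)) := by
      conv_lhs => rw [← h1]
      rw [← map_sub]
      congr 1
      rw [← hy, hv, smul_sub, add_smul, add_smul, one_smul, one_smul]
      abel
    rw [h2, ← norm_smul]
    have h3 := (hAs j).norm_resolvent_le (hRs j) (hTs j) ((z + 1) • (Rs j v - w))
    rwa [← le_inv_mul_iff₀ (abs_pos.2 hz)] at h3
  have h0 : Tendsto (fun j => Ts j y - Rs j v) atTop (𝓝 0) := by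
    refine squeeze_zero_norm hbound ?_
    have h5 : Tendsto (fun j => ‖Rs j v - w‖) atTop (𝓝 0) :=
      tendsto_iff_norm_sub_tendsto_zero.1 hwj
    simpa using (h5.const_mul ‖z + 1‖).const_mul |z.im|⁻¹
  simpa using h0.add hwj

end Abstract

/-! ### Calculus of locally absolutely continuous functions -/

lemma IsDerivOn.mono {U V : Set ℝ} {f g : ℝ → ℂ} (h : IsDerivOn U f g) (hVU : V ⊆ U) :
    IsDerivOn V f g :=
  fun a b hab hV => h a b hab (hV.trans hVU)

lemma IsDerivOn.sub_eq_integral {U : Set ℝ} {f g : ℝ → ℂ} (h : IsDerivOn U f g) {x y : ℝ}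
    (hxy : uIcc x y ⊆ U) : IntervalIntegrable g volume x y ∧ f y - f x = ∫ s in x..y, g s := by
  rcases le_total x y with hle | hle
  · rw [uIcc_of_le hle] at hxy
    exact h x y hle hxy
  · rw [uIcc_of_ge hle] at hxy
    obtain ⟨h1, h2⟩ := h y x hle hxy
    refine ⟨h1.symm, ?_⟩
    rw [intervalIntegral.integral_symm, ← h2]
    ring

/-- Being an indefinite integral is a local property. -/
lemma IsDerivOn.of_locally {U : Set ℝ} {f g : ℝ → ℂ}
    (h : ∀ x ∈ U, ∃ r > 0, IsDerivOn (Ioo (x - r) (x + r)) f g) : IsDerivOn U f g := by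
  intro a b hab hU
  refine IsPreconnected.induction₂ (s := Icc a b) isPreconnected_Icc
    (fun x y => IntervalIntegrable g volume x y ∧ f y - f x = ∫ s in x..y, g s)
    ?_ ?_ ?_ (left_mem_Icc.2 hab) (right_mem_Icc.2 hab)
  · intro x hx
    obtain ⟨r, hr, hd⟩ := h x (hU hx)
    filter_upwards [mem_nhdsWithin_of_mem_nhds (Ioo_mem_nhds (by linarith : x - r < x)
      (by linarith : x < x + r))] with y hy
    exact hd.sub_eq_integral (ordConnected_Ioo.uIcc_subset ⟨by linarith, by linarith⟩ hy)
  · rintro x y z - - - ⟨h1, h2⟩ ⟨h3, h4⟩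
    refine ⟨h1.trans h3, ?_⟩
    rw [← intervalIntegral.integral_add_adjacent_intervals h1 h3, ← h2, ← h4]
    ring
  · rintro x y - - ⟨h1, h2⟩
    refine ⟨h1.symm, ?_⟩
    rw [intervalIntegral.integral_symm, ← h2]
    ring

lemma IsDerivOn.congr {U : Set ℝ} {f f' g : ℝ → ℂ} (h : IsDerivOn U f g) (hf : EqOn f' f U) :
    IsDerivOn U f' g := by
  intro a b hab hU
  rw [hf (hU (left_mem_Icc.2 hab)), hf (hU (right_mem_Icc.2 hab))]
  exact h a b hab hU

lemma isDerivOn_const (U : Set ℝ) (c : ℂ) : IsDerivOn U (fun _ => c) 0 :=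
  fun a b _ _ => ⟨intervalIntegrable_const (c := (0 : ℂ)), by simp⟩

lemma isDerivOn_primitive {g : ℝ → ℂ} (hg : LocallyIntegrable g) (c : ℝ) (U : Set ℝ) :
    IsDerivOn U (fun x => ∫ s in c..x, g s) g := by
  intro a b _ _
  have hi : ∀ x y, IntervalIntegrable g volume x y := fun x y =>
    (hg.integrableOn_isCompact isCompact_uIcc).intervalIntegrable
  exact ⟨hi a b, intervalIntegral.integral_interval_sub_left (hi c b) (hi c a)⟩

lemma IsDerivOn.conj {U : Set ℝ} {f g : ℝ → ℂ} (h : IsDerivOn U f g) :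
    IsDerivOn U (fun x => (starRingEnd ℂ) (f x)) (fun x => (starRingEnd ℂ) (g x)) := by
  intro a b hab hU
  obtain ⟨h1, h2⟩ := h a b hab hU
  refine ⟨?_, ?_⟩
  · rw [intervalIntegrable_iff] at h1 ⊢
    exact (Complex.conjCLE.toContinuousLinearMap.integrable_comp h1 :)
  · rw [← map_sub, h2, intervalIntegral.intervalIntegral_conj]

/-- A complex-valued indefinite integral is absolutely continuous, by comparison with the indefinite
integral of the norm. -/
lemma absolutelyContinuousOnInterval_primitive {g : ℝ → ℂ} {a b : ℝ}
    (hg : IntervalIntegrable g volume a b) :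
    AbsolutelyContinuousOnInterval (fun x => ∫ s in a..x, g s) a b := by
  have hn := hg.norm.absolutelyContinuousOnInterval_intervalIntegral (c := a) (by simp)
  rw [absolutelyContinuousOnInterval_iff] at hn ⊢
  intro ε hε
  obtain ⟨δ, hδ, h⟩ := hn ε hε
  refine ⟨δ, hδ, fun E hE hlen => lt_of_le_of_lt (Finset.sum_le_sum fun i hi => ?_) (h E hE hlen)⟩
  have hmem := hE.1 i hi
  have hi1 : ∀ x ∈ uIcc a b, IntervalIntegrable g volume a x := fun x hx =>
    hg.mono_set (uIcc_subset_uIcc left_mem_uIcc hx)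
  rw [dist_eq_norm, dist_eq_norm,
    intervalIntegral.integral_interval_sub_left (hi1 _ hmem.1) (hi1 _ hmem.2),
    intervalIntegral.integral_interval_sub_left (hi1 _ hmem.1).norm (hi1 _ hmem.2).norm]
  exact intervalIntegral.norm_integral_le_abs_integral_norm

/-- The product rule for indefinite integrals: the difference of the two sides is an absolutely
continuous function with derivative `0` almost everywhere. -/
lemma IsDerivOn.mul {U : Set ℝ} {f g p q : ℝ → ℂ} (h : IsDerivOn U f g) (h' : IsDerivOn U p q) :
    IsDerivOn U (fun x => f x * p x) (fun x => g x * p x + f x * q x) := by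
  intro a b hab hU
  obtain ⟨hg, -⟩ := h a b hab hU
  obtain ⟨hq, -⟩ := h' a b hab hU
  let F : ℝ → ℂ := fun x => f a + ∫ s in a..x, g s
  let P : ℝ → ℂ := fun x => p a + ∫ s in a..x, q s
  have hF : ∀ x ∈ Icc a b, f x = F x := fun x hx => by
    simp only [F]
    rw [← (h a x hx.1 ((Icc_subset_Icc_right hx.2).trans hU)).2]; ring
  have hP : ∀ x ∈ Icc a b, p x = P x := fun x hx => by
    simp only [P]
    rw [← (h' a x hx.1 ((Icc_subset_Icc_right hx.2).trans hU)).2]; ring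
  have hconst : ∀ c : ℂ, AbsolutelyContinuousOnInterval (fun _ : ℝ => c) a b := fun c =>
    (contDiff_const.contDiffOn (n := 1)).absolutelyContinuousOnInterval
  have hFac : AbsolutelyContinuousOnInterval F a b :=
    (hconst (f a)).add (absolutelyContinuousOnInterval_primitive hg)
  have hPac : AbsolutelyContinuousOnInterval P a b :=
    (hconst (p a)).add (absolutelyContinuousOnInterval_primitive hq)
  have hw : IntervalIntegrable (fun x => g x * P x + F x * q x) volume a b :=
    (hg.mul_continuousOn hPac.continuousOn).add (hq.continuousOn_mul hFac.continuousOn)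
  have hac : AbsolutelyContinuousOnInterval
      (fun x => F x * P x - ∫ s in a..x, (g s * P s + F s * q s)) a b :=
    (hFac.fun_smul hPac).fun_sub
      (absolutelyContinuousOnInterval_primitive hw)
  obtain ⟨C, hC⟩ := hac.const_of_ae_hasDerivAt_zero (by
    filter_upwards [hg.ae_hasDerivAt_integral, hq.ae_hasDerivAt_integral,
      hw.ae_hasDerivAt_integral] with x h1 h2 h3 hx
    have d1 : HasDerivAt F (g x) x := (h1 hx a (by simp)).const_add _
    have d2 : HasDerivAt P (q x) x := (h2 hx a (by simp)).const_add _
    have d3 := (d1.fun_mul d2).fun_sub (h3 hx a (by simp))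
    rwa [sub_self] at d3)
  have hEq : EqOn (fun x => g x * p x + f x * q x) (fun x => g x * P x + F x * q x)
      (uIcc a b) := by
    intro x hx
    rw [uIcc_of_le hab] at hx
    simp only [hF x hx, hP x hx]
  refine ⟨IntervalIntegrable.congr (hEq.symm.mono uIoc_subset_uIcc) hw, ?_⟩
  rw [intervalIntegral.integral_congr hEq]
  have e := (hC b (by simp)).trans (hC a (by simp)).symm
  rw [intervalIntegral.integral_same] at e
  have ea : F a * P a = f a * p a := by
    rw [← hF a (left_mem_Icc.2 hab), ← hP a (left_mem_Icc.2 hab)]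
  have eb : F b * P b = f b * p b := by
    rw [← hF b (right_mem_Icc.2 hab), ← hP b (right_mem_Icc.2 hab)]
  rw [ea, eb] at e
  linear_combination e

/-- A function with integrable derivative on `(c, d)` is an indefinite integral over all of
`(c, d)`. -/
lemma IsDerivOn.eq_add_integral_indicator {c d : ℝ} {f g : ℝ → ℂ}
    (h : IsDerivOn (Ioo c d) f g) {m x : ℝ} (hm : m ∈ Ioo c d) (hx : x ∈ Ioo c d) :
    f x = f m + ∫ s in m..x, (Ioo c d).indicator g s := by
  have hsub : uIcc m x ⊆ Ioo c d := ordConnected_Ioo.uIcc_subset hm hx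
  rw [intervalIntegral.integral_congr (g := g) fun s hs => indicator_of_mem (hsub hs) g,
    ← (h.sub_eq_integral hsub).2]
  ring

/-- A function with integrable derivative on `(c, d)` extends continuously to `ℝ`. -/
lemma IsDerivOn.exists_continuous_eqOn {c d : ℝ} {f g : ℝ → ℂ} (h : IsDerivOn (Ioo c d) f g)
    (hg : IntegrableOn g (Ioo c d)) : ∃ F : ℝ → ℂ, Continuous F ∧ EqOn f F (Ioo c d) := by
  by_cases hcd : c < d
  · have hm : (c + d) / 2 ∈ Ioo c d := ⟨by linarith, by linarith⟩
    have hi : Integrable ((Ioo c d).indicator g) := hg.integrable_indicator measurableSet_Ioo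
    exact ⟨fun x => f ((c + d) / 2) + ∫ s in ((c + d) / 2)..x, (Ioo c d).indicator g s,
      continuous_const.add (intervalIntegral.continuous_primitive
        (fun _ _ => hi.intervalIntegrable) _), fun x hx => h.eq_add_integral_indicator hm hx⟩
  · exact ⟨0, continuous_const, fun x hx => absurd (hx.1.trans hx.2) hcd⟩

lemma IsDerivOn.exists_tendsto_right {t d : ℝ} (htd : t < d) {f g : ℝ → ℂ}
    (h : IsDerivOn (Ioo t d) f g) (hg : IntegrableOn g (Ioo t d)) :
    ∃ l, Tendsto f (𝓝[>] t) (𝓝 l) := by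
  obtain ⟨F, hF, hfF⟩ := h.exists_continuous_eqOn hg
  refine ⟨F t, (hF.continuousAt.tendsto.mono_left nhdsWithin_le_nhds).congr' ?_⟩
  filter_upwards [Ioo_mem_nhdsGT htd] with x hx using (hfF hx).symm

/-- Two indefinite integrals that meet continuously at `t` form one. -/
lemma IsDerivOn.glue {c t d : ℝ} (hct : c < t) (htd : t < d) {W w : ℝ → ℂ}
    (hl : IsDerivOn (Ioo c t) W w) (hr : IsDerivOn (Ioo t d) W w) (hw : IntegrableOn w (Ioo c d))
    (hlt : Tendsto W (𝓝[<] t) (𝓝 (W t))) (hrt : Tendsto W (𝓝[>] t) (𝓝 (W t))) :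
    IsDerivOn (Ioo c d) W w := by
  set G := (Ioo c d).indicator w
  have hGi : Integrable G := hw.integrable_indicator measurableSet_Ioo
  have hGii : ∀ x y, IntervalIntegrable G volume x y := fun _ _ => hGi.intervalIntegrable
  have hGw : EqOn G w (Ioo c d) := fun x hx => indicator_of_mem hx w
  have hcont : Continuous fun x => ∫ s in t..x, G s :=
    intervalIntegral.continuous_primitive hGii _
  have side : ∀ (I : Set ℝ) (l : Filter ℝ) [l.NeBot], I ⊆ Ioo c d → I.OrdConnected →
      IsDerivOn I W w → I ∈ l → l ≤ 𝓝 t → Tendsto W l (𝓝 (W t)) →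
      ∀ x ∈ I, W x = W t + ∫ s in t..x, G s := by
    intro I l _ hI hIo hd hIl hlt hW x hx
    have h1 : Tendsto (fun y => W y + ∫ s in y..x, G s) l (𝓝 (W t + ∫ s in t..x, G s)) := by
      have h2 : ∀ y, ∫ s in y..x, G s = (∫ s in t..x, G s) - ∫ s in t..y, G s := fun y =>
        (intervalIntegral.integral_interval_sub_left (hGii _ _) (hGii _ _)).symm
      rw [funext fun y => congrArg (W y + ·) (h2 y)]
      refine hW.add ?_
      have h3 := (hcont.tendsto t).mono_left hlt
      simp only [intervalIntegral.integral_same] at h3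
      simpa using h3.const_sub (∫ s in t..x, G s)
    have h4 : ∀ᶠ y in l, W y + ∫ s in y..x, G s = W x := by
      filter_upwards [hIl] with y hy
      have hsub : uIcc y x ⊆ I := hIo.uIcc_subset hy hx
      rw [intervalIntegral.integral_congr (hGw.mono (hsub.trans hI)),
        ← (hd.sub_eq_integral hsub).2]
      ring
    exact tendsto_nhds_unique (tendsto_const_nhds.congr' (h4.mono fun _ h => h.symm)) h1
  have hall : EqOn W (fun x => W t + ∫ s in t..x, G s) (Ioo c d) := by
    intro x hx
    rcases lt_trichotomy x t with h | h | h
    · exact side (Ioo c t) (𝓝[<] t) (Ioo_subset_Ioo_right htd.le) ordConnected_Ioo hl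
        (Ioo_mem_nhdsLT hct) nhdsWithin_le_nhds hlt x ⟨hx.1, h⟩
    · simp [h]
    · exact side (Ioo t d) (𝓝[>] t) (Ioo_subset_Ioo_left hct.le) ordConnected_Ioo hr
        (Ioo_mem_nhdsGT htd) nhdsWithin_le_nhds hrt x ⟨h, hx.2⟩
  intro a b hab hI
  have h1 := (isDerivOn_const (Ioo c d) (W t)).add (isDerivOn_primitive hGi.locallyIntegrable t _)
  obtain ⟨h2, h3⟩ := (h1.congr hall) a b hab hI
  have hE : EqOn (0 + G) w (uIcc a b) := by
    rw [uIcc_of_le hab, zero_add]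
    exact hGw.mono hI
  exact ⟨IntervalIntegrable.congr (hE.mono uIoc_subset_uIcc) h2, by
    rw [h3, intervalIntegral.integral_congr hE]⟩

/-- The derivative of an integrable function integrates to zero. -/
lemma IsDerivOn.integral_eq_zero {W w : ℝ → ℂ} (h : IsDerivOn univ W w) (hW : Integrable W)
    (hw : Integrable w) : ∫ x, w x = 0 := by
  have hW0 : ∀ x, W x = W 0 + ∫ s in (0 : ℝ)..x, w s := fun x => by
    rw [← (h.sub_eq_integral (subset_univ (uIcc 0 x))).2]; ring
  have htop : W 0 + ∫ x in Ioi 0, w x = 0 := by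
    refine IntegrableAtFilter.eq_zero_of_tendsto (hW.integrableAtFilter atTop) ?_
      (((intervalIntegral_tendsto_integral_Ioi 0 hw.integrableOn tendsto_id).const_add
        (W 0)).congr fun x => (hW0 x).symm)
    intro s hs
    obtain ⟨b, hb⟩ := mem_atTop_sets.1 hs
    exact measure_mono_top (fun x hx => hb x hx : Ici b ⊆ s) Real.volume_Ici
  have hbot : W 0 - ∫ x in Iic 0, w x = 0 := by
    refine IntegrableAtFilter.eq_zero_of_tendsto (hW.integrableAtFilter atBot) ?_
      (((intervalIntegral_tendsto_integral_Iic 0 hw.integrableOn tendsto_id).const_sub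
        (W 0)).congr fun x => ?_)
    · intro s hs
      obtain ⟨b, hb⟩ := mem_atBot_sets.1 hs
      exact measure_mono_top (fun x hx => hb x hx : Iic b ⊆ s) Real.volume_Iic
    · rw [hW0 x, intervalIntegral.integral_symm]
      simp [sub_eq_add_neg]
  rw [← intervalIntegral.integral_Iic_add_Ioi hw.integrableOn hw.integrableOn (b := 0)]
  linear_combination htop - hbot

/-! ### First-order pairs with jump conditions on the whole line -/

/-- A locally isolated set `S ⊆ ℝ` with a linear condition `k₊(t) f(t+) = k₋(t) f(t-)` at each of
its points. Off `S` the coefficients are `1`, where the condition expresses continuity. -/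
structure JumpData where
  /-- The set of points where a jump is allowed. -/
  S : Set ℝ
  /-- The coefficient of the left limit. -/
  km : ℝ → ℝ
  /-- The coefficient of the right limit. -/
  kp : ℝ → ℝ
  isolated : ∀ t, ∃ δ > 0, Icc (t - δ) (t + δ) ∩ S ⊆ {t}
  ne_zero : ∀ t, km t ≠ 0 ∨ kp t ≠ 0
  off : ∀ t ∉ S, km t = 1 ∧ kp t = 1

namespace JumpData

/-- The jump condition of the adjoint problem, with the two coefficients exchanged. -/
def swap (D : JumpData) : JumpData where
  S := D.S
  km := D.kp
  kp := D.km
  isolated := D.isolated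
  ne_zero t := (D.ne_zero t).symm
  off t ht := (D.off t ht).symm

lemma volume_S (D : JumpData) : volume D.S = 0 := by
  refine measure_null_of_locally_null _ fun t _ => ?_
  obtain ⟨δ, hδ, h⟩ := D.isolated t
  refine ⟨Icc (t - δ) (t + δ) ∩ D.S, ?_, measure_mono_null h (by simp)⟩
  rw [inter_comm]
  exact inter_mem_nhdsWithin _ (Icc_mem_nhds (by linarith) (by linarith))

end JumpData

/-- `f` is in `H¹` off `S` with derivative `g`, and satisfies the jump conditions of `D`. -/
structure IsFirstOrderPair (D : JumpData) (f g : ℝ → ℂ) : Prop where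
  memLp : MemLp f 2 volume
  memLp_deriv : MemLp g 2 volume
  deriv : IsDerivOn D.Sᶜ f g
  jump : ∀ t ∈ D.S, ∃ fm fp : ℂ, Tendsto f (𝓝[<] t) (𝓝 fm) ∧ Tendsto f (𝓝[>] t) (𝓝 fp) ∧
    (D.kp t : ℂ) * fp = D.km t * fm

/-- The interval `[c, d]` contains `t` in its interior and no point of `D.S` except possibly `t`. -/
structure IsWindow (D : JumpData) (c t d : ℝ) : Prop where
  left : c < t
  right : t < d
  inter_subset : Icc c d ∩ D.S ⊆ {t}

/-- The function supported in `[c, d]` with derivative `q` off `t`, for `q` supported in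
`[c, d]`: the integral of `q` from `c` on the left of `t`, and from `d` on the right. -/
def testFun (c t d : ℝ) (q : ℝ → ℂ) (x : ℝ) : ℂ :=
  (∫ s in c..x, q s) - (Ioi t).indicator (fun _ => ∫ s in c..d, q s) x

/-- The derivatives allowed in a test function on the window `(c, t, d)`: square integrable,
supported in `[c, d]`, and such that `testFun c t d q` satisfies `k₊ u(t+) = k₋ u(t-)`. -/
structure IsTestDeriv (km kp c t d : ℝ) (q : ℝ → ℂ) : Prop where
  memLp : MemLp q 2 volume
  eq_zero : ∀ x ∉ Icc c d, q x = 0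
  balance : (km : ℂ) * (∫ s in c..t, q s) + kp * ∫ s in t..d, q s = 0

lemma MemLp.intervalIntegrable_two {f : ℝ → ℂ} (hf : MemLp f 2 volume) (a b : ℝ) :
    IntervalIntegrable f volume a b :=
  ((hf.locallyIntegrable one_le_two).integrableOn_isCompact isCompact_uIcc).intervalIntegrable

lemma isDerivOn_primitive_of_memLp {f : ℝ → ℂ} (hf : MemLp f 2 volume) (c : ℝ) (U : Set ℝ) :
    IsDerivOn U (fun x => ∫ s in c..x, f s) f :=
  isDerivOn_primitive (hf.locallyIntegrable one_le_two) c U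

lemma continuous_primitive_of_memLp {f : ℝ → ℂ} (hf : MemLp f 2 volume) (c : ℝ) :
    Continuous fun x => ∫ s in c..x, f s :=
  intervalIntegral.continuous_primitive (MemLp.intervalIntegrable_two hf) c

section TestFun

variable {km kp c t d : ℝ} {q : ℝ → ℂ}

lemma testFun_of_le {x : ℝ} (hx : x ≤ t) : testFun c t d q x = ∫ s in c..x, q s := by
  simp [testFun, not_lt.2 hx]

lemma testFun_of_gt (hq : MemLp q 2 volume) {x : ℝ} (hx : t < x) :
    testFun c t d q x = ∫ s in d..x, q s := by
  have hi := MemLp.intervalIntegrable_two hq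
  rw [testFun, indicator_of_mem (mem_Ioi.2 hx)]
  exact intervalIntegral.integral_interval_sub_left (hi c x) (hi c d)

lemma testFun_eq_zero (hct : c < t) (htd : t < d) (hq : MemLp q 2 volume)
    (h0 : ∀ x ∉ Icc c d, q x = 0) {x : ℝ} (hx : x ∉ Icc c d) : testFun c t d q x = 0 := by
  rw [mem_Icc, not_and_or, not_le, not_le] at hx
  rcases hx with hx | hx
  · rw [testFun_of_le (by linarith), intervalIntegral.integral_symm,
      intervalIntegral.integral_zero_ae, neg_zero]
    have : ∀ᵐ y : ℝ, y ≠ c := by simp [ae_iff]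
    filter_upwards [this] with y hy hyc
    rw [uIoc_of_le hx.le] at hyc
    exact h0 y fun h => hy (le_antisymm hyc.2 h.1)
  · rw [testFun_of_gt hq (by linarith), intervalIntegral.integral_zero_ae]
    refine Eventually.of_forall fun y hy => h0 y fun h => ?_
    rw [uIoc_of_le hx.le] at hy
    linarith [hy.1, h.2]

lemma measurable_testFun (hq : MemLp q 2 volume) : Measurable (testFun c t d q) :=
  (continuous_primitive_of_memLp hq c).measurable.sub (measurable_const.indicator measurableSet_Ioi)

lemma memLp_testFun (hct : c < t) (htd : t < d) (hq : MemLp q 2 volume)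
    (h0 : ∀ x ∉ Icc c d, q x = 0) : MemLp (testFun c t d q) 2 volume := by
  have h1 : testFun c t d q = (Icc c d).indicator (testFun c t d q) := by
    ext x
    by_cases hx : x ∈ Icc c d
    · rw [indicator_of_mem hx]
    · rw [indicator_of_notMem hx, testFun_eq_zero hct htd hq h0 hx]
  rw [h1, memLp_indicator_iff_restrict measurableSet_Icc]
  obtain ⟨C, hC⟩ := isCompact_Icc.exists_bound_of_continuousOn (s := Icc c d)
    (continuous_primitive_of_memLp hq c).continuousOn
  refine MemLp.of_bound (measurable_testFun hq).aestronglyMeasurable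
    (C + ‖∫ s in c..d, q s‖) ((ae_restrict_iff' measurableSet_Icc).2 (Eventually.of_forall ?_))
  intro x hx
  refine (norm_sub_le _ _).trans (add_le_add (hC x hx) ?_)
  exact norm_indicator_le_norm_self (fun _ : ℝ => ∫ s in c..d, q s) x

end TestFun

/-- Test functions satisfy the jump conditions. -/
lemma IsWindow.isFirstOrderPair {D : JumpData} {c t d : ℝ} (hw : IsWindow D c t d) {q : ℝ → ℂ}
    (hq : IsTestDeriv (D.km t) (D.kp t) c t d q) :
    IsFirstOrderPair D (testFun c t d q) q := by
  have hi := MemLp.intervalIntegrable_two hq.memLp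
  refine ⟨memLp_testFun hw.left hw.right hq.memLp hq.eq_zero, hq.memLp, ?_, fun s hs => ?_⟩
  · by_cases ht : t ∈ D.S
    · intro a b hab hU
      obtain ⟨h1, h2⟩ := isDerivOn_primitive_of_memLp hq.memLp c univ a b hab (subset_univ _)
      refine ⟨h1, ?_⟩
      rcases lt_or_ge b t with hbt | hbt
      · rw [testFun_of_le hbt.le, testFun_of_le (hab.trans hbt.le)]
        exact h2
      · have hat : t < a := lt_of_not_ge fun h => hU ⟨h, hbt⟩ ht
        simp only [testFun, indicator_of_mem (mem_Ioi.2 hat),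
          indicator_of_mem (mem_Ioi.2 (hat.trans_le hab))]
        rw [← h2]
        ring
    · -- off `S` the balance condition says that `q` has total integral zero
      have hb := hq.balance
      rw [(D.off t ht).1, (D.off t ht).2, Complex.ofReal_one, one_mul, one_mul,
        intervalIntegral.integral_add_adjacent_intervals (hi c t) (hi t d)] at hb
      refine (isDerivOn_primitive_of_memLp hq.memLp c _).congr fun x _ => ?_
      simp [testFun, hb]
  · by_cases hst : s = t
    · subst hst
      refine ⟨∫ x in c..s, q x, ∫ x in d..s, q x, ?_, ?_, ?_⟩
      · refine ((continuous_primitive_of_memLp hq.memLp c).continuousAt.tendsto.mono_left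
          nhdsWithin_le_nhds).congr' ?_
        filter_upwards [self_mem_nhdsWithin] with x hx using (testFun_of_le (le_of_lt hx)).symm
      · refine ((continuous_primitive_of_memLp hq.memLp d).continuousAt.tendsto.mono_left
          nhdsWithin_le_nhds).congr' ?_
        filter_upwards [self_mem_nhdsWithin] with x hx using (testFun_of_gt hq.memLp hx).symm
      · rw [intervalIntegral.integral_symm s d]
        linear_combination -hq.balance
    · have hsI : s ∉ Icc c d := fun h => hst (hw.inter_subset ⟨h, hs⟩)
      have h0 : testFun c t d q =ᶠ[𝓝 s] fun _ => 0 := by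
        filter_upwards [isClosed_Icc.isOpen_compl.mem_nhds hsI] with x hx
        exact testFun_eq_zero hw.left hw.right hq.memLp hq.eq_zero hx
      refine ⟨0, 0, ?_, ?_, by simp⟩
      · exact tendsto_const_nhds.congr' (h0.filter_mono nhdsWithin_le_nhds).symm
      · exact tendsto_const_nhds.congr' (h0.filter_mono nhdsWithin_le_nhds).symm

/-! ### Integration by parts -/

open ComplexConjugate in
/-- The jump conditions of `D` and of `D.swap` are adjoint to each other: for pairs `(f, g)` and
`(p, q)` satisfying them, `f p̄` has no jumps, so that the boundary terms in the integration by
parts cancel. -/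
theorem IsFirstOrderPair.integral_eq_zero {D : JumpData} {f g p q : ℝ → ℂ}
    (h : IsFirstOrderPair D f g) (h' : IsFirstOrderPair D.swap p q) :
    ∫ x, (g x * conj (p x) + f x * conj (q x)) = 0 := by
  classical
  have hpc : MemLp (fun x => conj (p x)) 2 volume := h'.memLp.star
  have hqc : MemLp (fun x => conj (q x)) 2 volume := h'.memLp_deriv.star
  have hWi : Integrable fun x => f x * conj (p x) := h.memLp.integrable_mul hpc
  have hwi : Integrable fun x => g x * conj (p x) + f x * conj (q x) :=
    (h.memLp_deriv.integrable_mul hpc).add (h.memLp.integrable_mul hqc)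
  have hd : IsDerivOn D.Sᶜ (fun x => f x * conj (p x))
      (fun x => g x * conj (p x) + f x * conj (q x)) := h.deriv.mul h'.deriv.conj
  have hlim : ∀ t ∈ D.S, ∃ l, Tendsto (fun x => f x * conj (p x)) (𝓝[<] t) (𝓝 l) ∧
      Tendsto (fun x => f x * conj (p x)) (𝓝[>] t) (𝓝 l) := by
    intro t ht
    obtain ⟨fm, fp, h1, h2, h3⟩ := h.jump t ht
    obtain ⟨pm, pp, k1, k2, k3⟩ := h'.jump t ht
    simp only [JumpData.swap] at k3
    have cont : ∀ {l : Filter ℝ} {z : ℂ}, Tendsto p l (𝓝 z) →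
        Tendsto (fun x => conj (p x)) l (𝓝 (conj z)) := fun hl =>
      (Complex.continuous_conj.tendsto _).comp hl
    have k4 := congrArg conj k3
    simp only [map_mul, Complex.conj_ofReal] at k4
    have e : fp * conj pp = fm * conj pm := by
      rcases D.ne_zero t with hk | hk
      · have hk' : (D.km t : ℂ) ≠ 0 := Complex.ofReal_ne_zero.2 hk
        apply mul_left_cancel₀ hk'
        linear_combination fp * k4 + conj pm * h3
      · have hk' : (D.kp t : ℂ) ≠ 0 := Complex.ofReal_ne_zero.2 hk
        apply mul_left_cancel₀ hk'
        linear_combination conj pp * h3 + fm * k4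
    exact ⟨fm * conj pm, h1.mul (cont k1), e ▸ h2.mul (cont k2)⟩
  choose! l hl using hlim
  set W : ℝ → ℂ := fun x => if x ∈ D.S then l x else f x * conj (p x)
  have hoff : EqOn W (fun x => f x * conj (p x)) D.Sᶜ := fun x hx => if_neg hx
  have hae : W =ᵐ[volume] fun x => f x * conj (p x) := by
    filter_upwards [compl_mem_ae_iff.2 D.volume_S] with x hx using hoff hx
  refine IsDerivOn.integral_eq_zero (W := W) (IsDerivOn.of_locally fun t _ => ?_)
    (hWi.congr hae.symm) hwi
  obtain ⟨δ, hδ, hiso⟩ := D.isolated t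
  refine ⟨δ, hδ, ?_⟩
  have hS : ∀ x ∈ Ioo (t - δ) (t + δ), x ≠ t → x ∉ D.S := fun x hx hxt hxS =>
    hxt (hiso ⟨Ioo_subset_Icc_self hx, hxS⟩)
  by_cases ht : t ∈ D.S
  · have hleft : Ioo (t - δ) t ⊆ D.Sᶜ := fun x hx =>
      hS x ⟨hx.1, by linarith [hx.2]⟩ hx.2.ne
    have hright : Ioo t (t + δ) ⊆ D.Sᶜ := fun x hx =>
      hS x ⟨by linarith [hx.1], hx.2⟩ hx.1.ne'
    have hWt : W t = l t := if_pos ht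
    refine IsDerivOn.glue (by linarith) (by linarith)
      ((hd.mono hleft).congr (hoff.mono hleft)) ((hd.mono hright).congr (hoff.mono hright))
      hwi.integrableOn ?_ ?_
    · rw [hWt]
      refine (hl t ht).1.congr' ?_
      filter_upwards [Ioo_mem_nhdsLT (by linarith : t - δ < t)] with x hx using
        (hoff (hleft hx)).symm
    · rw [hWt]
      refine (hl t ht).2.congr' ?_
      filter_upwards [Ioo_mem_nhdsGT (by linarith : t < t + δ)] with x hx using
        (hoff (hright hx)).symm
  · have hsub : Ioo (t - δ) (t + δ) ⊆ D.Sᶜ := fun x hx => by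
      by_cases hxt : x = t
      · exact hxt ▸ ht
      · exact hS x hx hxt
    exact (hd.mono hsub).congr (hoff.mono hsub)

/-! ### Orthogonality to the test functions -/

open ComplexConjugate

/-- Integration by parts against a test function; the primitive of `a` that vanishes at `t` is used
so that the jump of the test function does not contribute. -/
lemma integral_conj_testFun_mul {c t d : ℝ} (hct : c < t) (htd : t < d) {a q : ℝ → ℂ}
    (ha : MemLp a 2 volume) (hq : MemLp q 2 volume) (h0 : ∀ x ∉ Icc c d, q x = 0) :
    ∫ x, conj (testFun c t d q x) * a x = -∫ x in c..d, (∫ s in t..x, a s) * conj (q x) := by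
  have hai := MemLp.intervalIntegrable_two ha
  have hqc : ∀ x y, IntervalIntegrable (fun x => conj (q x)) volume x y :=
    MemLp.intervalIntegrable_two (hq.star : MemLp (fun x => conj (q x)) 2 volume)
  have hcA : Continuous fun x => ∫ s in t..x, a s := continuous_primitive_of_memLp ha t
  have hAq : ∀ x y, IntervalIntegrable (fun x => (∫ s in t..x, a s) * conj (q x)) volume x y :=
    fun x y => (hqc x y).continuousOn_mul hcA.continuousOn
  have hpart : ∀ e : ℝ,
      ∫ x in e..t, conj (∫ s in e..x, q s) * a x = -∫ x in e..t, (∫ s in t..x, a s) * conj (q x)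
        := by
    intro e
    have hcQ : Continuous fun x => conj (∫ s in e..x, q s) :=
      Complex.continuous_conj.comp (continuous_primitive_of_memLp hq e)
    have h1 := ((isDerivOn_primitive_of_memLp ha t univ).mul
      (isDerivOn_primitive_of_memLp hq e univ).conj).sub_eq_integral (subset_univ (uIcc e t))
    have h2 := h1.2
    rw [intervalIntegral.integral_add ((hai e t).mul_continuousOn hcQ.continuousOn)
      (hAq e t)] at h2
    simp only [intervalIntegral.integral_same, zero_mul, map_zero, mul_zero, sub_zero] at h2
    rw [eq_neg_iff_add_eq_zero, h2]
    simp only [mul_comm]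
  have hu : ∀ x ∉ Icc c d, conj (testFun c t d q x) * a x = 0 := fun x hx => by
    rw [testFun_eq_zero hct htd hq h0 hx, map_zero, zero_mul]
  have hui : ∀ x y, IntervalIntegrable (fun x => conj (testFun c t d q x) * a x) volume x y :=
    fun x y => ((memLp_testFun hct htd hq h0).star.integrable_mul ha).intervalIntegrable
  have e1 : ∫ x in c..t, conj (testFun c t d q x) * a x =
      ∫ x in c..t, conj (∫ s in c..x, q s) * a x := by
    refine intervalIntegral.integral_congr fun x hx => ?_
    rw [uIcc_of_le hct.le] at hx
    simp only [testFun_of_le hx.2]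
  have e2 : ∫ x in t..d, conj (testFun c t d q x) * a x =
      ∫ x in t..d, conj (∫ s in d..x, q s) * a x := by
    refine intervalIntegral.integral_congr_ae (Eventually.of_forall fun x hx => ?_)
    rw [uIoc_of_le htd.le] at hx
    simp only [testFun_of_gt hq hx.1]
  have e3 := hpart d
  rw [intervalIntegral.integral_symm t d, intervalIntegral.integral_symm t d, neg_neg,
    neg_eq_iff_eq_neg] at e3
  rw [← setIntegral_eq_integral_of_forall_compl_eq_zero (s := Icc c d) fun x hx => hu x hx,
    integral_Icc_eq_integral_Ioc, ← intervalIntegral.integral_of_le (hct.trans htd).le,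
    ← intervalIntegral.integral_add_adjacent_intervals (hui c t) (hui t d), e1, e2, hpart c, e3,
    ← intervalIntegral.integral_add_adjacent_intervals (hAq c t) (hAq t d)]
  ring

/-- The step function with value `km` on the left of `t` and `kp` on the right. -/
def stepFun (km kp t x : ℝ) : ℝ := if x < t then km else kp

lemma measurable_stepFun (km kp t : ℝ) : Measurable (stepFun km kp t) :=
  Measurable.ite measurableSet_Iio measurable_const measurable_const

lemma abs_stepFun_le (km kp t x : ℝ) : |stepFun km kp t x| ≤ max |km| |kp| := by
  rw [stepFun]
  split_ifs
  · exact le_max_left _ _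
  · exact le_max_right _ _

lemma memLp_stepFun_indicator (km kp t c d : ℝ) :
    MemLp ((Icc c d).indicator fun x => (stepFun km kp t x : ℂ)) 2 volume := by
  rw [memLp_indicator_iff_restrict measurableSet_Icc]
  refine MemLp.of_bound
    (Complex.measurable_ofReal.comp (measurable_stepFun km kp t)).aestronglyMeasurable
    (max |km| |kp|) (Eventually.of_forall fun x => ?_)
  rw [Complex.norm_real]
  exact abs_stepFun_le km kp t x

/-- The balance condition of a test function is orthogonality to the step function. -/
lemma integral_stepFun_mul {c t d : ℝ} (hct : c < t) (htd : t < d) (km kp : ℝ) {q : ℝ → ℂ}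
    (hq : MemLp q 2 volume) :
    ∫ x in Icc c d, (stepFun km kp t x : ℂ) * q x =
      (km : ℂ) * (∫ s in c..t, q s) + kp * ∫ s in t..d, q s := by
  have hi := MemLp.intervalIntegrable_two hq
  have e1 : EqOn (fun x => (km : ℂ) * q x) (fun x => (stepFun km kp t x : ℂ) * q x)
      (uIoo c t) := by
    intro x hx
    rw [uIoo_of_le hct.le] at hx
    simp only [stepFun, if_pos hx.2]
  have e2 : EqOn (fun x => (kp : ℂ) * q x) (fun x => (stepFun km kp t x : ℂ) * q x)
      (uIoo t d) := by
    intro x hx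
    rw [uIoo_of_le htd.le] at hx
    simp only [stepFun, if_neg (not_lt.2 hx.1.le)]
  have i1 := ((hi c t).const_mul (km : ℂ)).congr_uIoo e1
  have i2 := ((hi t d).const_mul (kp : ℂ)).congr_uIoo e2
  rw [integral_Icc_eq_integral_Ioc, ← intervalIntegral.integral_of_le (hct.trans htd).le,
    ← intervalIntegral.integral_add_adjacent_intervals i1 i2,
    ← intervalIntegral.integral_const_mul, ← intervalIntegral.integral_const_mul]
  rw [intervalIntegral.integral_congr_uIoo e1, intervalIntegral.integral_congr_uIoo e2]

lemma stepFun_sq_integral_pos {c t d : ℝ} (hct : c < t) (htd : t < d) {km kp : ℝ}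
    (hk : km ≠ 0 ∨ kp ≠ 0) : 0 < km ^ 2 * (t - c) + kp ^ 2 * (d - t) := by
  have h1 : 0 < t - c := by linarith
  have h2 : 0 < d - t := by linarith
  rcases hk with hk | hk <;> positivity

lemma integral_stepFun_mul_stepFun {c t d : ℝ} (hct : c < t) (htd : t < d) (km kp lm lp : ℝ) :
    ∫ x in Icc c d, (stepFun km kp t x : ℂ) * stepFun lm lp t x =
      ((km * lm * (t - c) + kp * lp * (d - t) : ℝ) : ℂ) := by
  have h := integral_stepFun_mul hct htd km kp (memLp_stepFun_indicator lm lp t c d)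
  have e0 : ∫ x in Icc c d, (stepFun km kp t x : ℂ) * stepFun lm lp t x =
      ∫ x in Icc c d, (stepFun km kp t x : ℂ) *
        (Icc c d).indicator (fun x => (stepFun lm lp t x : ℂ)) x :=
    setIntegral_congr_fun measurableSet_Icc fun x hx => by
      simp only [indicator_of_mem hx]
  have e1 : ∫ s in c..t, (Icc c d).indicator (fun x => (stepFun lm lp t x : ℂ)) s =
      ∫ s in c..t, (lm : ℂ) := by
    refine intervalIntegral.integral_congr_uIoo fun x hx => ?_
    rw [uIoo_of_le hct.le] at hx
    simp only [indicator_of_mem (show x ∈ Icc c d from ⟨hx.1.le, by linarith [hx.2]⟩), stepFun,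
      if_pos hx.2]
  have e2 : ∫ s in t..d, (Icc c d).indicator (fun x => (stepFun lm lp t x : ℂ)) s =
      ∫ s in t..d, (lp : ℂ) := by
    refine intervalIntegral.integral_congr_uIoo fun x hx => ?_
    rw [uIoo_of_le htd.le] at hx
    simp only [indicator_of_mem (show x ∈ Icc c d from ⟨by linarith [hx.1], hx.2.le⟩), stepFun,
      if_neg (not_lt.2 hx.1.le)]
  rw [e0, h, e1, e2, intervalIntegral.integral_const, intervalIntegral.integral_const]
  simp only [Complex.real_smul]
  push_cast
  ring

/-- The lemma of du Bois-Reymond with a jump: if `(a, g)` is orthogonal to all test functions on a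
window, then there `g` is a primitive of `a` plus a multiple of the step function with values
`k₋`, `k₊`. The test derivative used is the remainder itself, minus its projection onto the step
function. -/
lemma exists_ae_eq_of_orthogonal_testFun {c t d km kp : ℝ} (hct : c < t) (htd : t < d)
    (hk : km ≠ 0 ∨ kp ≠ 0) {a g : ℝ → ℂ} (ha : MemLp a 2 volume) (hg : MemLp g 2 volume)
    (h : ∀ q, IsTestDeriv km kp c t d q →
      (∫ x, conj (testFun c t d q x) * a x) + ∫ x, conj (q x) * g x = 0) :
    ∃ C : ℂ, ∀ᵐ x, x ∈ Icc c d → g x = (∫ s in t..x, a s) + C * stepFun km kp t x := by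
  have hcA : Continuous fun x => ∫ s in t..x, a s := continuous_primitive_of_memLp ha t
  set r : ℝ → ℂ := (Icc c d).indicator fun x => g x - ∫ s in t..x, a s with hr
  set k : ℝ → ℂ := (Icc c d).indicator fun x => (stepFun km kp t x : ℂ) with hkdef
  have hk2 : MemLp k 2 volume := memLp_stepFun_indicator km kp t c d
  have hr2 : MemLp r 2 volume := by
    have h1 : MemLp ((Icc c d).indicator fun x => ∫ s in t..x, a s) 2 volume := by
      rw [memLp_indicator_iff_restrict measurableSet_Icc]
      obtain ⟨B, hB⟩ := isCompact_Icc.exists_bound_of_continuousOn (s := Icc c d) hcA.continuousOn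
      exact MemLp.of_bound hcA.aestronglyMeasurable B
        ((ae_restrict_iff' measurableSet_Icc).2 (Eventually.of_forall hB))
    have e : r = (Icc c d).indicator g - (Icc c d).indicator fun x => ∫ s in t..x, a s := by
      ext x
      by_cases hx : x ∈ Icc c d <;> simp [hr, hx]
    rw [e]
    exact (hg.indicator measurableSet_Icc).sub h1
  set N : ℝ := km ^ 2 * (t - c) + kp ^ 2 * (d - t) with hN
  have hNpos : 0 < N := stepFun_sq_integral_pos hct htd hk
  set C : ℂ := (∫ x in Icc c d, (stepFun km kp t x : ℂ) * r x) / (N : ℂ) with hC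
  set q : ℝ → ℂ := fun x => r x - C * k x with hq
  have hq2 : MemLp q 2 volume := hr2.sub (hk2.const_mul C)
  have hq0 : ∀ x ∉ Icc c d, q x = 0 := fun x hx => by
    simp only [hq, hr, hkdef, indicator_of_notMem hx, mul_zero, sub_zero]
  have hkk : ∫ x in Icc c d, (stepFun km kp t x : ℂ) * k x = N := by
    have e : ∫ x in Icc c d, (stepFun km kp t x : ℂ) * k x =
        ∫ x in Icc c d, (stepFun km kp t x : ℂ) * stepFun km kp t x :=
      setIntegral_congr_fun measurableSet_Icc fun x hx => by
        simp only [hkdef, indicator_of_mem hx]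
    rw [e, integral_stepFun_mul_stepFun hct htd, hN]
    congr 1
    ring
  have hkq : ∫ x in Icc c d, (stepFun km kp t x : ℂ) * q x = 0 := by
    have i : ∀ {p : ℝ → ℂ}, MemLp p 2 volume →
        IntegrableOn (fun x => (stepFun km kp t x : ℂ) * p x) (Icc c d) := by
      intro p hp
      have := (hk2.integrable_mul hp).integrableOn (s := Icc c d)
      refine this.congr_fun (fun x hx => ?_) measurableSet_Icc
      simp only [hkdef, Pi.mul_apply, indicator_of_mem hx]
    have e : ∀ x, (stepFun km kp t x : ℂ) * q x =
        (stepFun km kp t x : ℂ) * r x - C * ((stepFun km kp t x : ℂ) * k x) := fun x => by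
      simp only [hq]; ring
    simp only [e]
    rw [integral_sub (i hr2) ((i hk2).const_mul C), integral_const_mul, hkk, hC,
      div_mul_cancel₀ _ (Complex.ofReal_ne_zero.2 hNpos.ne'), sub_self]
  have hqt : IsTestDeriv km kp c t d q :=
    ⟨hq2, hq0, by rw [← integral_stepFun_mul hct htd km kp hq2, hkq]⟩
  have h1 := h q hqt
  rw [integral_conj_testFun_mul hct htd ha hq2 hq0,
    intervalIntegral.integral_of_le (hct.trans htd).le, ← integral_Icc_eq_integral_Ioc] at h1
  have iq : ∀ {p : ℝ → ℂ}, MemLp p 2 volume → Integrable fun x => conj (q x) * p x :=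
    fun hp => (hq2.star : MemLp (fun x => conj (q x)) 2 volume).integrable_mul hp
  have h2 : ∫ x, conj (q x) * r x = 0 := by
    have hz : ∀ (p : ℝ → ℂ), ∫ x in Icc c d, conj (q x) * p x = ∫ x, conj (q x) * p x := fun p =>
      setIntegral_eq_integral_of_forall_compl_eq_zero fun x hx => by
        rw [hq0 x hx, map_zero, zero_mul]
    rw [← hz, ← h1, ← hz g]
    have e : ∫ x in Icc c d, conj (q x) * r x =
        ∫ x in Icc c d, (conj (q x) * g x - (∫ s in t..x, a s) * conj (q x)) :=
      setIntegral_congr_fun measurableSet_Icc fun x hx => by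
        simp only [hr, indicator_of_mem hx]; ring
    rw [e, integral_sub (iq hg).integrableOn]
    · ring
    · have := ((MemLp.intervalIntegrable_two (hq2.star :
        MemLp (fun x => conj (q x)) 2 volume) c d).continuousOn_mul hcA.continuousOn).1
      exact (integrableOn_Icc_iff_integrableOn_Ioc).2 this
  have h3 : ∫ x, conj (q x) * k x = 0 := by
    have e : ∫ x, conj (q x) * k x = conj (∫ x in Icc c d, (stepFun km kp t x : ℂ) * q x) := by
      rw [← integral_conj, ← integral_indicator measurableSet_Icc]
      refine integral_congr_ae (Eventually.of_forall fun x => ?_)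
      by_cases hx : x ∈ Icc c d
      · simp only [hkdef, indicator_of_mem hx, map_mul, Complex.conj_ofReal]
        ring
      · simp only [hkdef, indicator_of_notMem hx, mul_zero]
    rw [e, hkq, map_zero]
  have h4 : ∫ x, conj (q x) * q x = 0 := by
    have e : ∀ x, conj (q x) * q x = conj (q x) * r x - C * (conj (q x) * k x) := fun x => by
      have : q x = r x - C * k x := rfl
      conv_lhs => rw [this]
      rw [this]
      ring
    simp only [e]
    rw [integral_sub (iq hr2) ((iq hk2).const_mul C), integral_const_mul, h2, h3]
    ring
  have h5 : ∀ᵐ x, q x = 0 := by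
    have e : ∫ x, conj (q x) * q x = ((∫ x, ‖q x‖ ^ 2 : ℝ) : ℂ) := by
      rw [← integral_complex_ofReal]
      refine integral_congr_ae (Eventually.of_forall fun x => ?_)
      simp only [Complex.conj_mul', Complex.ofReal_pow]
    rw [e, Complex.ofReal_eq_zero,
      integral_eq_zero_iff_of_nonneg (fun x => sq_nonneg _)
        (hq2.integrable_norm_pow two_ne_zero)] at h4
    filter_upwards [h4] with x hx
    simpa using hx
  refine ⟨C, ?_⟩
  filter_upwards [h5] with x hx hxI
  simp only [hq, hr, hkdef, indicator_of_mem hxI] at hx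
  linear_combination hx

/-- A pair orthogonal to all test pairs of `D` satisfies, with its components exchanged, the adjoint
jump conditions. -/
theorem exists_isFirstOrderPair_of_orthogonal {D : JumpData} {a g : ℝ → ℂ}
    (ha : MemLp a 2 volume) (hg : MemLp g 2 volume)
    (h : ∀ c t d, IsWindow D c t d → ∀ q, IsTestDeriv (D.km t) (D.kp t) c t d q →
      (∫ x, conj (testFun c t d q x) * a x) + ∫ x, conj (q x) * g x = 0) :
    ∃ f, f =ᵐ[volume] g ∧ IsFirstOrderPair D.swap f a := by
  have hai := MemLp.intervalIntegrable_two ha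
  have hloc : ∀ t, ∃ δ > 0, Icc (t - δ) (t + δ) ∩ D.S ⊆ {t} ∧ ∃ C : ℂ, ∀ᵐ x,
      x ∈ Icc (t - δ) (t + δ) →
        g x = (∫ s in t..x, a s) + C * stepFun (D.km t) (D.kp t) t x := by
    intro t
    obtain ⟨δ, hδ, hiso⟩ := D.isolated t
    exact ⟨δ, hδ, hiso, exists_ae_eq_of_orthogonal_testFun (by linarith) (by linarith)
      (D.ne_zero t) ha hg (h _ _ _ ⟨by linarith, by linarith, hiso⟩)⟩
  choose δ hδ hiso C hC using hloc
  have hoff : ∀ t, ∀ x ∈ Ioo (t - δ t) (t + δ t), x ≠ t → x ∉ D.S := fun t x hx hxt hxS =>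
    hxt (hiso t ⟨Ioo_subset_Icc_self hx, hxS⟩)
  -- the value at `y` of the local representative around `y` agrees with that around `t`, since
  -- both represent `g` near `y`
  have hval : ∀ t, ∀ y ∈ Ioo (t - δ t) (t + δ t), y ≠ t →
      C y = (∫ s in t..y, a s) + C t * stepFun (D.km t) (D.kp t) t y := by
    intro t y hy hyt
    have hyS := D.off y (hoff t y hy hyt)
    have hstep : ∀ᶠ s in 𝓝 y,
        stepFun (D.km t) (D.kp t) t s = stepFun (D.km t) (D.kp t) t y := by
      rcases lt_or_gt_of_ne hyt with hlt | hgt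
      · filter_upwards [Iio_mem_nhds hlt] with s hs
        rw [stepFun, stepFun, if_pos hlt, if_pos (mem_Iio.1 hs)]
      · filter_upwards [Ioi_mem_nhds hgt] with s hs
        rw [stepFun, stepFun, if_neg (not_lt.2 hgt.le), if_neg (not_lt.2 (le_of_lt hs))]
    have hn1 : ∀ᶠ s in 𝓝 y, s ∈ Icc (t - δ t) (t + δ t) := Icc_mem_nhds hy.1 hy.2
    have hn2 : ∀ᶠ s in 𝓝 y, s ∈ Icc (y - δ y) (y + δ y) :=
      Icc_mem_nhds (by linarith [hδ y]) (by linarith [hδ y])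
    obtain ⟨s, ⟨hs1, hs2⟩, hs3, hs4, hs5⟩ :=
      ((mem_closure_iff_frequently.1 (Measure.dense_of_ae ((hC t).and (hC y)) y)).and_eventually
        (hn1.and (hn2.and hstep))).exists
    have e1 := hs1 hs3
    have e2 := hs2 hs4
    have e3 : stepFun (D.km y) (D.kp y) y s = 1 := by simp [stepFun, hyS.1, hyS.2]
    rw [hs5] at e1
    rw [e3, Complex.ofReal_one, mul_one] at e2
    have e4 := intervalIntegral.integral_add_adjacent_intervals (hai t y) (hai y s)
    linear_combination e1 - e2 - e4
  set f : ℝ → ℂ := fun x => C x with hf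
  have hfg : f =ᵐ[volume] g := by
    refine measure_null_of_locally_null _ fun t _ => ?_
    refine ⟨_, inter_mem_nhdsWithin _ (Ioo_mem_nhds (by linarith [hδ t] : t - δ t < t)
      (by linarith [hδ t] : t < t + δ t)), ?_⟩
    have hne : ∀ᵐ y : ℝ, y ≠ t := by simp [ae_iff]
    have : ∀ᵐ y : ℝ, ¬ (y ∈ {x | f x = g x}ᶜ ∩ Ioo (t - δ t) (t + δ t)) := by
      filter_upwards [hne, hC t] with y hyt hy ⟨h1, h2⟩
      exact h1 ((hval t y h2 hyt).trans (hy (Ioo_subset_Icc_self h2)).symm)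
    simpa [ae_iff] using! this
  refine ⟨f, hfg, (memLp_congr_ae hfg).2 hg, ha, IsDerivOn.of_locally fun t ht => ?_,
    fun t ht => ?_⟩
  · refine ⟨δ t, hδ t, ?_⟩
    have h1 := (isDerivOn_const (Ioo (t - δ t) (t + δ t)) (C t)).add
      (isDerivOn_primitive_of_memLp ha t _)
    rw [zero_add] at h1
    refine h1.congr fun y hy => ?_
    by_cases hyt : y = t
    · simp [hf, hyt]
    · simp only [hf, hval t y hy hyt, stepFun, (D.off t ht).1, (D.off t ht).2, ite_self,
        Pi.add_apply]
      push_cast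
      ring
  · have hcont : ∀ k : ℝ, Tendsto (fun y => (∫ s in t..y, a s) + C t * k) (𝓝 t)
        (𝓝 (C t * k)) := fun k => by
      have := ((continuous_primitive_of_memLp ha t).tendsto t).add_const (C t * k)
      simpa using this
    refine ⟨C t * D.km t, C t * D.kp t, ?_, ?_, ?_⟩
    · refine ((hcont (D.km t)).mono_left nhdsWithin_le_nhds).congr' ?_
      filter_upwards [Ioo_mem_nhdsLT (by linarith [hδ t] : t - δ t < t)] with y hy
      simp only [hf, hval t y ⟨hy.1, by linarith [hy.2, hδ t]⟩ hy.2.ne, stepFun, if_pos hy.2]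
    · refine ((hcont (D.kp t)).mono_left nhdsWithin_le_nhds).congr' ?_
      filter_upwards [Ioo_mem_nhdsGT (by linarith [hδ t] : t < t + δ t)] with y hy
      simp only [hf, hval t y ⟨by linarith [hy.1, hδ t], hy.2⟩ hy.1.ne', stepFun,
        if_neg (not_lt.2 hy.1.le)]
    · simp only [JumpData.swap]
      ring

/-! ### Approximation of test functions under convergence of the jump data -/

lemma eLpNorm_two_le_of_bound {f : ℝ → ℂ} {B a b : ℝ} (hB : ∀ x, ‖f x‖ ≤ B)
    (h0 : ∀ x ∉ uIcc a b, f x = 0) :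
    eLpNorm f 2 volume ≤ ENNReal.ofReal (B * √|b - a|) := by
  have hB0 : 0 ≤ B := (norm_nonneg (f 0)).trans (hB 0)
  have h1 : eLpNorm f 2 volume ≤ eLpNorm ((uIcc a b).indicator fun _ => B) 2 volume := by
    refine eLpNorm_mono_real fun x => ?_
    by_cases hx : x ∈ uIcc a b
    · rw [indicator_of_mem hx]
      exact hB x
    · rw [indicator_of_notMem hx, h0 x hx, norm_zero]
  refine h1.trans (le_of_eq ?_)
  rw [eLpNorm_indicator_const measurableSet_uIcc two_ne_zero ENNReal.ofNat_ne_top,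
    Real.volume_interval, Real.enorm_eq_ofReal hB0, ENNReal.ofReal_mul hB0,
    ENNReal.ofReal_rpow_of_nonneg (abs_nonneg _) (by norm_num), Real.sqrt_eq_rpow]
  simp

lemma norm_stepFun_indicator_le (km kp t c d x : ℝ) :
    ‖(Icc c d).indicator (fun x => (stepFun km kp t x : ℂ)) x‖ ≤ max |km| |kp| := by
  refine (norm_indicator_le_norm_self _ x).trans ?_
  rw [Complex.norm_real]
  exact abs_stepFun_le km kp t x

lemma norm_testFun_stepFun_le {c t d : ℝ} (hct : c < t) (htd : t < d) (km kp x : ℝ) :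
    ‖testFun c t d ((Icc c d).indicator fun x => (stepFun km kp t x : ℂ)) x‖ ≤
      2 * (max |km| |kp| * (d - c)) := by
  have hcd : c < d := hct.trans htd
  have hM : 0 ≤ max |km| |kp| := (abs_nonneg km).trans (le_max_left _ _)
  by_cases hx : x ∈ Icc c d
  · have hint : ∀ y ∈ Icc c d,
        ‖∫ s in c..y, (Icc c d).indicator (fun x => (stepFun km kp t x : ℂ)) s‖ ≤
          max |km| |kp| * (d - c) := by
      intro y hy
      refine (intervalIntegral.norm_integral_le_of_norm_le_const fun s _ =>
        norm_stepFun_indicator_le km kp t c d s).trans ?_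
      rw [abs_of_nonneg (sub_nonneg.2 hy.1)]
      exact mul_le_mul_of_nonneg_left (by linarith [hy.2]) hM
    rw [two_mul, testFun]
    exact (norm_sub_le _ _).trans (add_le_add (hint x hx)
      ((norm_indicator_le_norm_self (fun _ : ℝ => _) x).trans (hint d ⟨hcd.le, le_rfl⟩)))
  · rw [testFun_eq_zero hct htd (memLp_stepFun_indicator km kp t c d)
      (fun y hy => indicator_of_notMem hy _) hx, norm_zero]
    have : 0 ≤ d - c := by linarith
    positivity

lemma testFun_sub_const_mul {c t d : ℝ} {q k : ℝ → ℂ} (hq : MemLp q 2 volume)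
    (hk : MemLp k 2 volume) (l : ℂ) (x : ℝ) :
    testFun c t d (fun s => q s - l * k s) x = testFun c t d q x - l * testFun c t d k x := by
  have hqi := MemLp.intervalIntegrable_two hq
  have hki := MemLp.intervalIntegrable_two hk
  have e : ∀ y, ∫ s in c..y, (q s - l * k s) = (∫ s in c..y, q s) - l * ∫ s in c..y, k s :=
    fun y => by
      rw [intervalIntegral.integral_sub (hqi c y) ((hki c y).const_mul l),
        intervalIntegral.integral_const_mul]
  simp only [testFun, e]
  by_cases hx : x ∈ Ioi t
  · simp only [indicator_of_mem hx]
    ring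
  · simp only [indicator_of_notMem hx]
    ring

lemma eLpNorm_testFun_sub_le (c t s d : ℝ) (q : ℝ → ℂ) :
    eLpNorm (testFun c s d q - testFun c t d q) 2 volume ≤
      ENNReal.ofReal (‖∫ y in c..d, q y‖ * √|s - t|) := by
  refine eLpNorm_two_le_of_bound (fun x => ?_) fun x hx => ?_
  · simp only [Pi.sub_apply, testFun, indicator, mem_Ioi]
    split_ifs <;> simp
  · rw [mem_uIcc, not_or, not_and_or, not_and_or, not_le, not_le, not_le, not_le] at hx
    simp only [Pi.sub_apply, testFun, indicator, mem_Ioi]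
    have : t < x ↔ s < x := by
      constructor <;> intro h <;> rcases hx with ⟨h1 | h1, h2 | h2⟩ <;> linarith
    simp [this]

/-- A test derivative for the jump condition at `t` is the limit of test derivatives for nearby
jump conditions at nearby points; they are obtained by projecting off the step functions of
the approximating conditions. -/
lemma exists_tendsto_isTestDeriv {c t d km kp : ℝ} (hct : c < t) (htd : t < d)
    (hk : km ≠ 0 ∨ kp ≠ 0) {τ kms kps : ℕ → ℝ} (hτ : ∀ j, τ j ∈ Ioo c d)
    (hks : ∀ j, kms j ≠ 0 ∨ kps j ≠ 0) (hτt : Tendsto τ atTop (𝓝 t))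
    (hkm : Tendsto kms atTop (𝓝 km)) (hkp : Tendsto kps atTop (𝓝 kp)) {q : ℝ → ℂ}
    (hq : IsTestDeriv km kp c t d q) :
    ∃ qs : ℕ → ℝ → ℂ, (∀ j, IsTestDeriv (kms j) (kps j) c (τ j) d (qs j)) ∧
      Tendsto (fun j => eLpNorm (qs j - q) 2 volume) atTop (𝓝 0) ∧
      Tendsto (fun j => eLpNorm (testFun c (τ j) d (qs j) - testFun c t d q) 2 volume)
        atTop (𝓝 0) := by
  set N : ℕ → ℝ := fun j => kms j ^ 2 * (τ j - c) + kps j ^ 2 * (d - τ j) with hN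
  set b : ℕ → ℂ := fun j =>
    (kms j : ℂ) * (∫ s in c..τ j, q s) + kps j * ∫ s in τ j..d, q s with hb
  set l : ℕ → ℂ := fun j => b j / N j
  set k : ℕ → ℝ → ℂ := fun j => (Icc c d).indicator fun x => (stepFun (kms j) (kps j) (τ j) x : ℂ)
    with hkdef
  set B : ℕ → ℝ := fun j => max |kms j| |kps j|
  have hk2 : ∀ j, MemLp (k j) 2 volume := fun j => memLp_stepFun_indicator _ _ _ _ _
  have hk0 : ∀ j, ∀ x ∉ Icc c d, k j x = 0 := fun j x hx => indicator_of_notMem hx _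
  have hNpos : ∀ j, 0 < N j := fun j => stepFun_sq_integral_pos (hτ j).1 (hτ j).2 (hks j)
  have hNlim : Tendsto N atTop (𝓝 (km ^ 2 * (t - c) + kp ^ 2 * (d - t))) :=
    ((hkm.pow 2).mul (hτt.sub_const c)).add ((hkp.pow 2).mul (hτt.const_sub d))
  have hblim : Tendsto b atTop (𝓝 0) := by
    rw [← hq.balance]
    have h1 := ((continuous_primitive_of_memLp hq.memLp c).tendsto t).comp hτt
    have h2 := (((continuous_primitive_of_memLp hq.memLp d).tendsto t).comp hτt).neg
    simp only [Function.comp_def, ← intervalIntegral.integral_symm] at h1 h2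
    exact (((Complex.continuous_ofReal.tendsto _).comp hkm).mul h1).add
      (((Complex.continuous_ofReal.tendsto _).comp hkp).mul h2)
  have hllim : Tendsto l atTop (𝓝 0) := by
    have h1 := hblim.div ((Complex.continuous_ofReal.tendsto _).comp hNlim)
      (Complex.ofReal_ne_zero.2 (stepFun_sq_integral_pos hct htd hk).ne')
    rwa [zero_div] at h1
  have hlnorm : Tendsto (fun j => ‖l j‖) atTop (𝓝 0) := by simpa using hllim.norm
  have hBlim : Tendsto B atTop (𝓝 (max |km| |kp|)) := hkm.abs.max hkp.abs
  refine ⟨fun j x => q x - l j * k j x, fun j => ⟨hq.memLp.sub ((hk2 j).const_mul (l j)),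
    fun x hx => by simp only [hq.eq_zero x hx, hk0 j x hx, mul_zero, sub_zero], ?_⟩, ?_, ?_⟩
  · have hqi := MemLp.intervalIntegrable_two hq.memLp
    have hki := MemLp.intervalIntegrable_two (hk2 j)
    have e : ∀ x y, ∫ s in x..y, (q s - l j * k j s) =
        (∫ s in x..y, q s) - l j * ∫ s in x..y, k j s := fun x y => by
      rw [intervalIntegral.integral_sub (hqi x y) ((hki x y).const_mul (l j)),
        intervalIntegral.integral_const_mul]
    have h1 := integral_stepFun_mul (hτ j).1 (hτ j).2 (kms j) (kps j) (hk2 j)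
    have h2 : ∫ x in Icc c d, (stepFun (kms j) (kps j) (τ j) x : ℂ) * k j x = N j := by
      have h3 : ∫ x in Icc c d, (stepFun (kms j) (kps j) (τ j) x : ℂ) * k j x =
          ∫ x in Icc c d, (stepFun (kms j) (kps j) (τ j) x : ℂ) *
            stepFun (kms j) (kps j) (τ j) x :=
        setIntegral_congr_fun measurableSet_Icc fun x hx => by
          simp only [hkdef, indicator_of_mem hx]
      rw [h3, integral_stepFun_mul_stepFun (hτ j).1 (hτ j).2, hN]
      congr 1
      ring
    have h4 : l j * N j = b j := div_mul_cancel₀ _ (Complex.ofReal_ne_zero.2 (hNpos j).ne')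
    rw [h2] at h1
    rw [e, e]
    simp only [hb] at h4
    rw [h1] at h4
    linear_combination -h4
  · have hbound : ∀ j, eLpNorm ((fun x => q x - l j * k j x) - q) 2 volume ≤
        ENNReal.ofReal (‖l j‖ * B j * √|d - c|) := by
      intro j
      refine eLpNorm_two_le_of_bound (fun x => ?_) fun x hx => ?_
      · simp only [Pi.sub_apply, sub_sub_cancel_left, norm_neg, norm_mul]
        exact mul_le_mul_of_nonneg_left (norm_stepFun_indicator_le _ _ _ _ _ _) (norm_nonneg _)
      · rw [uIcc_of_le (hct.trans htd).le] at hx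
        simp [hk0 j x hx]
    refine tendsto_of_tendsto_of_tendsto_of_le_of_le tendsto_const_nhds ?_
      (fun _ => zero_le) hbound
    have := ENNReal.tendsto_ofReal ((hlnorm.mul hBlim).mul_const √|d - c|)
    simpa using this
  · have hmeas : ∀ s, ∀ p : ℝ → ℂ, MemLp p 2 volume →
        AEStronglyMeasurable (testFun c s d p) volume :=
      fun s p hp => (measurable_testFun hp).aestronglyMeasurable
    have hbound : ∀ j,
        eLpNorm (testFun c (τ j) d (fun x => q x - l j * k j x) - testFun c t d q) 2 volume ≤
        ENNReal.ofReal (‖∫ y in c..d, q y‖ * √|τ j - t|) +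
          ENNReal.ofReal (‖l j‖ * (2 * (B j * (d - c))) * √|d - c|) := by
      intro j
      have e : testFun c (τ j) d (fun x => q x - l j * k j x) - testFun c t d q =
          (testFun c (τ j) d q - testFun c t d q) - fun x => l j * testFun c (τ j) d (k j) x := by
        ext x
        simp only [Pi.sub_apply, testFun_sub_const_mul hq.memLp (hk2 j)]
        ring
      rw [e]
      refine (eLpNorm_sub_le ((hmeas _ _ hq.memLp).sub (hmeas _ _ hq.memLp))
        ((hmeas _ _ (hk2 j)).const_mul _) one_le_two).trans
        (add_le_add (eLpNorm_testFun_sub_le c t (τ j) d q) (eLpNorm_two_le_of_bound (fun x => ?_)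
          fun x hx => ?_))
      · rw [norm_mul]
        exact mul_le_mul_of_nonneg_left (norm_testFun_stepFun_le (hτ j).1 (hτ j).2 _ _ _)
          (norm_nonneg _)
      · rw [uIcc_of_le (hct.trans htd).le] at hx
        rw [testFun_eq_zero (hτ j).1 (hτ j).2 (hk2 j) (hk0 j) hx, mul_zero]
    refine tendsto_of_tendsto_of_tendsto_of_le_of_le tendsto_const_nhds ?_
      (fun _ => zero_le) hbound
    have h1 : Tendsto (fun j => ‖∫ y in c..d, q y‖ * √|τ j - t|) atTop (𝓝 0) := by
      have h3 := ((hτt.sub_const t).abs.sqrt).const_mul ‖∫ y in c..d, q y‖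
      simpa using h3
    have h2 : Tendsto (fun j => ‖l j‖ * (2 * (B j * (d - c))) * √|d - c|) atTop (𝓝 0) := by
      have h3 := (hlnorm.mul ((hBlim.mul_const (d - c)).const_mul 2)).mul_const √|d - c|
      simpa using h3
    simpa using (ENNReal.tendsto_ofReal h1).add (ENNReal.tendsto_ofReal h2)

/-! ### The projection onto the first-order pairs -/

/-- The complex Hilbert space `L²(ℝ)`. -/
abbrev L2Line : Type := Lp ℂ 2 (volume : Measure ℝ)

/-- The Hilbert space `L²(ℝ) ⊕ L²(ℝ)` of pairs of a function and its derivative. -/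
abbrev PairSpace : Type := WithLp 2 (L2Line × L2Line)

/-- The element of `PairSpace` represented by two square integrable functions. -/
def mkPair {f g : ℝ → ℂ} (hf : MemLp f 2 volume) (hg : MemLp g 2 volume) : PairSpace :=
  WithLp.toLp 2 (hf.toLp f, hg.toLp g)

lemma inner_mkPair {f g : ℝ → ℂ} (hf : MemLp f 2 volume) (hg : MemLp g 2 volume)
    (x : PairSpace) :
    inner ℂ (mkPair hf hg) x = (∫ s, conj (f s) * x.fst s) + ∫ s, conj (g s) * x.snd s := by
  have key : ∀ {h : ℝ → ℂ} (hh : MemLp h 2 volume) (y : L2Line),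
      inner ℂ (hh.toLp h) y = ∫ s, conj (h s) * y s := by
    intro h hh y
    rw [L2.inner_def]
    refine integral_congr_ae ?_
    filter_upwards [hh.coeFn_toLp] with s hs
    rw [hs, RCLike.inner_apply, mul_comm]
  rw [WithLp.prod_inner_apply]
  exact congrArg₂ (· + ·) (key hf _) (key hg _)

lemma IsFirstOrderPair.integral_add_integral_eq_zero {D : JumpData} {f g p q : ℝ → ℂ}
    (h : IsFirstOrderPair D f g) (h' : IsFirstOrderPair D.swap p q) :
    (∫ x, conj (p x) * g x) + ∫ x, conj (q x) * f x = 0 := by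
  have i1 : Integrable fun x => conj (p x) * g x :=
    (h'.memLp.star : MemLp (fun x => conj (p x)) 2 volume).integrable_mul h.memLp_deriv
  have i2 : Integrable fun x => conj (q x) * f x :=
    (h'.memLp_deriv.star : MemLp (fun x => conj (q x)) 2 volume).integrable_mul h.memLp
  rw [← integral_add i1 i2, ← h.integral_eq_zero h']
  exact integral_congr_ae (Eventually.of_forall fun x => by ring)

lemma IsFirstOrderPair.congr_deriv {D : JumpData} {f g g' : ℝ → ℂ} (h : IsFirstOrderPair D f g)
    (hg : g' =ᵐ[volume] g) : IsFirstOrderPair D f g' := by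
  refine ⟨h.memLp, (memLp_congr_ae hg).2 h.memLp_deriv, fun a b hab hU => ?_, h.jump⟩
  obtain ⟨h1, h2⟩ := h.deriv a b hab hU
  exact ⟨h1.congr_ae (ae_restrict_of_ae hg.symm), by
    rw [h2]; exact intervalIntegral.integral_congr_ae (hg.symm.mono fun x hx _ => hx)⟩

namespace JumpData

/-- The test pairs of `D`, as elements of the Hilbert space. -/
def testSet (D : JumpData) : Set PairSpace :=
  {x | ∃ c t d q, ∃ (hw : IsWindow D c t d) (hq : IsTestDeriv (D.km t) (D.kp t) c t d q),
    x = mkPair (hw.isFirstOrderPair hq).memLp hq.memLp}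

/-- The orthogonal complement of the test pairs. -/
def testOrthogonal (D : JumpData) : Submodule ℂ PairSpace := (Submodule.span ℂ D.testSet)ᗮ

instance (D : JumpData) : D.testOrthogonal.HasOrthogonalProjection := by
  unfold testOrthogonal
  infer_instance

lemma mem_testOrthogonal (D : JumpData) (x : PairSpace) :
    x ∈ D.testOrthogonal ↔ ∃ f, f =ᵐ[volume] x.snd ∧ IsFirstOrderPair D.swap f x.fst := by
  constructor
  · intro hx
    refine exists_isFirstOrderPair_of_orthogonal (Lp.memLp _) (Lp.memLp _) ?_
    intro c t d hw q hq
    rw [← inner_mkPair (hw.isFirstOrderPair hq).memLp hq.memLp]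
    exact hx _ (Submodule.subset_span ⟨c, t, d, q, hw, hq, rfl⟩)
  · rintro ⟨f, hfx, hf⟩
    rw [testOrthogonal, Submodule.mem_orthogonal]
    intro y hy
    induction hy using Submodule.span_induction with
    | mem y hy =>
      obtain ⟨c, t, d, q, hw, hq, rfl⟩ := hy
      rw [inner_mkPair]
      rw [← hf.integral_add_integral_eq_zero (D := D.swap) (hw.isFirstOrderPair hq)]
      congr 1
      refine integral_congr_ae ?_
      filter_upwards [hfx] with s hs
      rw [hs]
    | zero => exact inner_zero_left _
    | add y z _ _ h1 h2 => rw [inner_add_left, h1, h2, add_zero]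
    | smul a y _ h1 => rw [inner_smul_left, h1, mul_zero]

/-- The closed span of the test pairs consists of all pairs that satisfy the jump conditions. -/
lemma mem_orthogonal_testOrthogonal (D : JumpData) (x : PairSpace) :
    x ∈ D.testOrthogonalᗮ ↔ ∃ f, f =ᵐ[volume] x.fst ∧ IsFirstOrderPair D f x.snd := by
  constructor
  · intro hx
    refine exists_isFirstOrderPair_of_orthogonal (D := D.swap) (Lp.memLp _) (Lp.memLp _) ?_
    intro c t d hw q hq
    have hu := hw.isFirstOrderPair hq
    rw [add_comm, ← inner_mkPair hq.memLp hu.memLp]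
    refine hx _ ((mem_testOrthogonal D _).2 ⟨_, hu.memLp.coeFn_toLp.symm, ?_⟩)
    exact hu.congr_deriv hq.memLp.coeFn_toLp
  · rintro ⟨f, hfx, hf⟩
    rw [Submodule.mem_orthogonal]
    intro y hy
    obtain ⟨p, hpy, hp⟩ := (mem_testOrthogonal D y).1 hy
    have e : y = mkPair hp.memLp_deriv hp.memLp := by
      refine (WithLp.ofLp_injective 2) (Prod.ext ?_ ?_)
      · exact (Lp.toLp_coeFn y.fst hp.memLp_deriv).symm
      · exact Lp.ext (hpy.symm.trans hp.memLp.coeFn_toLp.symm)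
    rw [e, inner_mkPair, ← hf.integral_add_integral_eq_zero hp, add_comm]
    congr 1
    refine integral_congr_ae ?_
    filter_upwards [hfx] with s hs
    rw [hs]

/-! ### The bounded inverse on the whole line -/

/-- The first component of the projection of `(v, 0)` onto the pairs satisfying the jump conditions;
this is the solution `u` of `u - u'' = v`. -/
def solve (D : JumpData) : L2Line →L[ℂ] L2Line :=
  (WithLp.fstL 2 ℂ L2Line L2Line ∘L D.testOrthogonalᗮ.starProjection) ∘L
    ((WithLp.prodContinuousLinearEquiv 2 ℂ L2Line L2Line).symm.toContinuousLinearMap ∘L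
      ContinuousLinearMap.inl ℂ L2Line L2Line)

lemma solve_apply (D : JumpData) (v : L2Line) :
    D.solve v = (D.testOrthogonalᗮ.starProjection (WithLp.toLp 2 (v, 0))).fst := rfl

lemma isSelfAdjoint_solve (D : JumpData) : IsSelfAdjoint D.solve := by
  rw [ContinuousLinearMap.isSelfAdjoint_iff_isSymmetric]
  intro v w
  have key : ∀ (y : PairSpace) (u : L2Line),
      inner ℂ y (WithLp.toLp 2 (u, (0 : L2Line))) = inner ℂ y.fst u := fun y u => by
    rw [WithLp.prod_inner_apply]
    simp
  have key' : ∀ (y : PairSpace) (u : L2Line),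
      inner ℂ (WithLp.toLp 2 (u, (0 : L2Line)) : PairSpace) y = inner ℂ u y.fst := fun y u => by
    rw [WithLp.prod_inner_apply]
    simp
  simp only [ContinuousLinearMap.coe_coe, solve_apply]
  rw [← key, ← key']
  exact Submodule.inner_starProjection_left_eq_right _ _ _

/-- `u = solve v` means that `u` solves `u - u'' = v`, written as a first-order system. -/
lemma solve_eq_iff (D : JumpData) (u v : L2Line) :
    D.solve v = u ↔ ∃ f f₁, f =ᵐ[volume] u ∧ IsFirstOrderPair D f f₁ ∧
      IsFirstOrderPair D.swap f₁ (u - v : L2Line) := by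
  constructor
  · rintro rfl
    set x : PairSpace := WithLp.toLp 2 (v, 0) with hx
    set y : PairSpace := D.testOrthogonalᗮ.starProjection x with hy
    obtain ⟨f, hfu, hf⟩ := (mem_orthogonal_testOrthogonal D y).1
      (Submodule.starProjection_apply_mem _ _)
    have hmem : y - x ∈ D.testOrthogonal := by
      have h1 : x - y ∈ D.testOrthogonalᗮᗮ := Submodule.sub_starProjection_mem_orthogonal x
      rw [Submodule.orthogonal_orthogonal] at h1
      simpa using neg_mem h1
    obtain ⟨f₁, hf1, hf1'⟩ := (mem_testOrthogonal D _).1 hmem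
    have e1 : (y - x).fst = y.fst - v := rfl
    have e2 : (y - x).snd = y.snd := by
      have : (y - x).snd = y.snd - 0 := rfl
      rw [this, sub_zero]
    rw [e2] at hf1
    rw [e1] at hf1'
    exact ⟨f, f₁, hfu, hf.congr_deriv hf1, hf1'⟩
  · rintro ⟨f, f₁, hfu, hf, hf1⟩
    set y : PairSpace := WithLp.toLp 2 (u, hf1.memLp.toLp f₁) with hy
    set x : PairSpace := WithLp.toLp 2 (v, 0) with hx
    have h1 : y ∈ D.testOrthogonalᗮ := (mem_orthogonal_testOrthogonal D y).2
      ⟨f, hfu, hf.congr_deriv hf1.memLp.coeFn_toLp⟩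
    have h2 : y - x ∈ D.testOrthogonal := by
      refine (mem_testOrthogonal D _).2 ⟨f₁, ?_, hf1⟩
      have : (y - x).snd = hf1.memLp.toLp f₁ - 0 := rfl
      rw [this, sub_zero]
      exact hf1.memLp.coeFn_toLp.symm
    have h3 : x - y ∈ D.testOrthogonalᗮᗮ := by
      rw [Submodule.orthogonal_orthogonal]
      simpa using neg_mem h2
    rw [solve_apply, ← hx, Submodule.eq_starProjection_of_mem_orthogonal h1 h3]
    rfl

/-! ### Strong convergence of the projections -/

/-- Convergence of jump data: in every window at `t` all but finitely many of the data have at most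
one point, these points tend to `t`, and the coefficients there tend to those of the limit. -/
def Converges (Ds : ℕ → JumpData) (D : JumpData) : Prop :=
  ∀ c t d, IsWindow D c t d → ∃ τ : ℕ → ℝ, Tendsto τ atTop (𝓝 t) ∧
    (∀ᶠ j in atTop, Icc c d ∩ (Ds j).S ⊆ {τ j}) ∧
    Tendsto (fun j => (Ds j).km (τ j)) atTop (𝓝 (D.km t)) ∧
    Tendsto (fun j => (Ds j).kp (τ j)) atTop (𝓝 (D.kp t))

lemma Converges.swap {Ds : ℕ → JumpData} {D : JumpData} (h : Converges Ds D) :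
    Converges (fun j => (Ds j).swap) D.swap := by
  intro c t d hw
  obtain ⟨τ, h1, h2, h3, h4⟩ := h c t d ⟨hw.left, hw.right, hw.inter_subset⟩
  exact ⟨τ, h1, h2, h4, h3⟩

/-- Test pairs of the limit data are limits of pairs satisfying the approximating conditions. -/
lemma Converges.exists_approx {Ds : ℕ → JumpData} {D : JumpData} (h : Converges Ds D)
    {c t d : ℝ} {q : ℝ → ℂ} (hw : IsWindow D c t d)
    (hq : IsTestDeriv (D.km t) (D.kp t) c t d q) :
    ∃ (us qs : ℕ → ℝ → ℂ) (hu : ∀ j, MemLp (us j) 2 volume) (hqs : ∀ j, MemLp (qs j) 2 volume),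
      (∀ᶠ j in atTop, IsFirstOrderPair (Ds j) (us j) (qs j)) ∧
      Tendsto (fun j => (hu j).toLp (us j)) atTop
        (𝓝 ((hw.isFirstOrderPair hq).memLp.toLp (testFun c t d q))) ∧
      Tendsto (fun j => (hqs j).toLp (qs j)) atTop (𝓝 (hq.memLp.toLp q)) := by
  classical
  obtain ⟨τ, hτ, hS, hkm, hkp⟩ := h c t d hw
  -- replacing finitely many terms, all the points may be taken inside the window
  set σ : ℕ → ℝ := fun j => if τ j ∈ Ioo c d then τ j else t with hσ
  have hστ : ∀ᶠ j in atTop, σ j = τ j := by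
    filter_upwards [hτ.eventually (Ioo_mem_nhds hw.left hw.right)] with j hj using if_pos hj
  have hσmem : ∀ j, σ j ∈ Ioo c d := fun j => by
    simp only [hσ]
    split_ifs with hj
    · exact hj
    · exact ⟨hw.left, hw.right⟩
  obtain ⟨qs, h1, h2, h3⟩ := exists_tendsto_isTestDeriv hw.left hw.right (D.ne_zero t) hσmem
    (fun j => (Ds j).ne_zero (σ j)) (hτ.congr' (hστ.mono fun j hj => hj.symm))
    (hkm.congr' (hστ.mono fun j hj => by simp only [hj]))
    (hkp.congr' (hστ.mono fun j hj => by simp only [hj])) hq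
  refine ⟨fun j => testFun c (σ j) d (qs j), qs,
    fun j => memLp_testFun (hσmem j).1 (hσmem j).2 (h1 j).memLp (h1 j).eq_zero,
    fun j => (h1 j).memLp, ?_, ?_, ?_⟩
  · filter_upwards [hS, hστ] with j hj hj'
    exact IsWindow.isFirstOrderPair ⟨(hσmem j).1, (hσmem j).2, by rwa [hj']⟩ (h1 j)
  · exact (Lp.tendsto_Lp_iff_tendsto_eLpNorm'' _ _ _ _).2 h3
  · exact (Lp.tendsto_Lp_iff_tendsto_eLpNorm'' _ _ _ _).2 h2

end JumpData

/-- If `x` is approximated by elements of the subspaces `K j`, then the projections of `x` onto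
the `K j` tend to `x`. -/
lemma tendsto_starProjection_of_approx {E : Type*} [NormedAddCommGroup E]
    [InnerProductSpace ℂ E] (K : ℕ → Submodule ℂ E) [∀ j, (K j).HasOrthogonalProjection]
    {x : E} {xs : ℕ → E} (hxs : Tendsto xs atTop (𝓝 x)) (hK : ∀ᶠ j in atTop, xs j ∈ K j) :
    Tendsto (fun j => (K j).starProjection x) atTop (𝓝 x) := by
  have h0 : Tendsto (fun j => (K j).starProjection x - xs j) atTop (𝓝 0) := by
    refine squeeze_zero_norm' (a := fun j => ‖xs j - x‖) ?_
      (tendsto_iff_norm_sub_tendsto_zero.1 hxs)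
    filter_upwards [hK] with j hj
    have e : (K j).starProjection x - xs j = (K j).starProjection (x - xs j) := by
      rw [map_sub, Submodule.starProjection_eq_self_iff.2 hj]
    rw [e, norm_sub_rev (xs j)]
    exact Submodule.norm_starProjection_apply_le _ _
  simpa using h0.add hxs

/-- Strong convergence of uniformly bounded operators needs to be checked only on a set with
dense span. -/
lemma tendsto_clm_of_span_orthogonal_eq_bot {E : Type*} [NormedAddCommGroup E]
    [InnerProductSpace ℂ E] [CompleteSpace E] {P : ℕ → E →L[ℂ] E} {Q : E →L[ℂ] E}
    (hP : ∀ j x, ‖P j x‖ ≤ ‖x‖) (hQ : ∀ x, ‖Q x‖ ≤ ‖x‖) {s : Set E}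
    (hs : (Submodule.span ℂ s)ᗮ = ⊥)
    (hlim : ∀ x ∈ s, Tendsto (fun j => P j x) atTop (𝓝 (Q x))) (x : E) :
    Tendsto (fun j => P j x) atTop (𝓝 (Q x)) := by
  have hspan : ∀ y ∈ Submodule.span ℂ s, Tendsto (fun j => P j y) atTop (𝓝 (Q y)) := by
    intro y hy
    induction hy using Submodule.span_induction with
    | mem y hy => exact hlim y hy
    | zero => simp
    | add y z _ _ h1 h2 => simpa using h1.add h2
    | smul a y _ h1 => simpa using h1.const_smul a
  have hdense : Dense (Submodule.span ℂ s : Set E) := by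
    rw [Submodule.dense_iff_topologicalClosure_eq_top, Submodule.topologicalClosure_eq_top_iff]
    exact hs
  rw [Metric.tendsto_atTop]
  intro ε hε
  obtain ⟨y, hy, hxy⟩ := hdense.exists_dist_lt x (by linarith : 0 < ε / 3)
  obtain ⟨n, hn⟩ := Metric.tendsto_atTop.1 (hspan y hy) (ε / 3) (by linarith)
  refine ⟨n, fun j hj => ?_⟩
  have h1 : dist (P j x) (P j y) ≤ dist x y := by
    rw [dist_eq_norm, dist_eq_norm, ← map_sub]
    exact hP j _
  have h2 : dist (Q y) (Q x) ≤ dist y x := by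
    rw [dist_eq_norm, dist_eq_norm, ← map_sub]
    exact hQ _
  rw [dist_comm y x] at h2
  linarith [dist_triangle4 (P j x) (P j y) (Q y) (Q x), hn j hj]

namespace JumpData

/-- Convergence of the jump data implies strong convergence of the inverses, because the projections
converge on the test pairs of the limit and on the adjoint test pairs, which together span a dense
subspace. -/
theorem Converges.tendsto_solve {Ds : ℕ → JumpData} {D : JumpData} (h : Converges Ds D)
    (v : L2Line) : Tendsto (fun j => (Ds j).solve v) atTop (𝓝 (D.solve v)) := by
  have hpair : ∀ {us qs : ℕ → L2Line} {u q : L2Line}, Tendsto us atTop (𝓝 u) →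
      Tendsto qs atTop (𝓝 q) →
      Tendsto (fun j => (WithLp.toLp 2 (us j, qs j) : PairSpace)) atTop
        (𝓝 (WithLp.toLp 2 (u, q))) := fun h1 h2 =>
    ((WithLp.prod_continuous_toLp 2 L2Line L2Line).tendsto _).comp (h1.prodMk_nhds h2)
  have hproj : ∀ x : PairSpace, Tendsto (fun j => (Ds j).testOrthogonalᗮ.starProjection x) atTop
      (𝓝 (D.testOrthogonalᗮ.starProjection x)) := by
    refine tendsto_clm_of_span_orthogonal_eq_bot
      (s := D.testSet ∪ {x | WithLp.toLp 2 (x.snd, x.fst) ∈ D.swap.testSet})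
      (fun j x => Submodule.norm_starProjection_apply_le _ _)
      (fun x => Submodule.norm_starProjection_apply_le _ _) ?_ ?_
    · -- a vector orthogonal to both families lies in `testOrthogonal` and in its complement
      rw [Submodule.eq_bot_iff]
      intro y hy
      have h1 : y ∈ D.testOrthogonal :=
        Submodule.orthogonal_le (Submodule.span_mono subset_union_left) hy
      have h2 : y ∈ D.testOrthogonalᗮ := by
        have h3 : (WithLp.toLp 2 (y.snd, y.fst) : PairSpace) ∈ D.swap.testOrthogonal := by
          rw [testOrthogonal, Submodule.mem_orthogonal]
          intro z hz
          induction hz using Submodule.span_induction with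
          | mem z hz =>
            have h4 := hy (WithLp.toLp 2 (z.snd, z.fst))
              (Submodule.subset_span (Or.inr hz))
            rw [WithLp.prod_inner_apply] at h4 ⊢
            rw [← h4, add_comm]
            rfl
          | zero => exact inner_zero_left _
          | add y z _ _ h1 h2 => rw [inner_add_left, h1, h2, add_zero]
          | smul a y _ h1 => rw [inner_smul_left, h1, mul_zero]
        exact (mem_orthogonal_testOrthogonal D y).2 ((mem_testOrthogonal D.swap _).1 h3)
      exact inner_self_eq_zero.1 (h2 y h1)
    · rintro x (⟨c, t, d, q, hw, hq, rfl⟩ | ⟨c, t, d, q, hw, hq, hx⟩)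
      · obtain ⟨us, qs, hu, hqs, h1, h2, h3⟩ := h.exists_approx hw hq
        have hfix : D.testOrthogonalᗮ.starProjection
            (mkPair (hw.isFirstOrderPair hq).memLp hq.memLp) =
            mkPair (hw.isFirstOrderPair hq).memLp hq.memLp :=
          Submodule.starProjection_eq_self_iff.2 ((mem_orthogonal_testOrthogonal D _).2
            ⟨_, (hw.isFirstOrderPair hq).memLp.coeFn_toLp.symm,
              (hw.isFirstOrderPair hq).congr_deriv hq.memLp.coeFn_toLp⟩)
        rw [hfix]
        refine tendsto_starProjection_of_approx _ (hpair h2 h3) ?_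
        filter_upwards [h1] with j hj
        exact (mem_orthogonal_testOrthogonal (Ds j) _).2
          ⟨_, (hu j).coeFn_toLp.symm, hj.congr_deriv (hqs j).coeFn_toLp⟩
      · obtain ⟨us, qs, hu, hqs, h1, h2, h3⟩ := h.swap.exists_approx hw hq
        have hx1 : x.snd = (hw.isFirstOrderPair hq).memLp.toLp _ :=
          congrArg WithLp.fst hx
        have hx2 : x.fst = hq.memLp.toLp _ := congrArg WithLp.snd hx
        have hmem : x ∈ D.testOrthogonal := (mem_testOrthogonal D x).2
          ⟨_, hx1 ▸ (hw.isFirstOrderPair hq).memLp.coeFn_toLp.symm,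
            hx2 ▸ (hw.isFirstOrderPair hq).congr_deriv hq.memLp.coeFn_toLp⟩
        have hxe : x = WithLp.toLp 2 (hq.memLp.toLp q,
            (hw.isFirstOrderPair hq).memLp.toLp _) := by
          rw [← hx1, ← hx2]
          rfl
        have h4 : Tendsto (fun j => (Ds j).testOrthogonal.starProjection x) atTop (𝓝 x) := by
          refine tendsto_starProjection_of_approx _ (hxe ▸ hpair h3 h2) ?_
          filter_upwards [h1] with j hj
          exact (mem_testOrthogonal (Ds j) _).2
            ⟨_, (hu j).coeFn_toLp.symm, hj.congr_deriv (hqs j).coeFn_toLp⟩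
        have h5 : D.testOrthogonal.starProjection x = x :=
          Submodule.starProjection_eq_self_iff.2 hmem
        simp only [Submodule.starProjection_orthogonal_val, h5]
        exact h4.const_sub x
  exact ((WithLp.fstL 2 ℂ L2Line L2Line).continuous.tendsto _).comp (hproj (WithLp.toLp 2 (v, 0)))

end JumpData

/-! ### From the whole line to the half-line -/

/-- The restriction of functions from `ℝ` to `(0, ∞)`. -/
def restrictHalf : L2Line →L[ℂ] L2Half := LpToLpRestrictCLM ℝ ℂ ℂ volume 2 (Ioi 0)

lemma restrictHalf_coeFn (u : L2Line) : restrictHalf u =ᵐ[volume.restrict (Ioi 0)] u :=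
  LpToLpRestrictCLM_coeFn ℂ (Ioi 0) u

/-- The adjoint of the restriction to `(0, ∞)` is extension by zero. -/
lemma adjoint_restrictHalf_coeFn (v : L2Half) :
    restrictHalf.adjoint v =ᵐ[volume] (Ioi 0).indicator v := by
  have hv : MemLp ((Ioi (0 : ℝ)).indicator v) 2 volume :=
    (memLp_indicator_iff_restrict measurableSet_Ioi).2 (Lp.memLp v)
  have e : restrictHalf.adjoint v = hv.toLp _ := by
    refine ext_inner_right ℂ fun w => ?_
    rw [ContinuousLinearMap.adjoint_inner_left, L2.inner_def, L2.inner_def,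
      ← integral_indicator measurableSet_Ioi]
    have h1 := (ae_restrict_iff' measurableSet_Ioi).1 (restrictHalf_coeFn w)
    refine integral_congr_ae ?_
    filter_upwards [h1, hv.coeFn_toLp] with x hx1 hx2
    rw [hx2]
    by_cases hx : x ∈ Ioi (0 : ℝ)
    · rw [indicator_of_mem hx, indicator_of_mem hx, hx1 hx]
    · rw [indicator_of_notMem hx, indicator_of_notMem hx, inner_zero_left]
  rw [e]
  exact hv.coeFn_toLp

lemma restrictHalf_adjoint (v : L2Half) : restrictHalf (restrictHalf.adjoint v) = v := by
  refine Lp.ext ((restrictHalf_coeFn _).trans ?_)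
  filter_upwards [ae_restrict_of_ae (s := Ioi 0) (adjoint_restrictHalf_coeFn v),
    ae_restrict_mem measurableSet_Ioi] with x hx hx0
  rw [hx, indicator_of_mem hx0]

lemma jumpCondition_iff {β t : ℝ} (hβ : 1 ≤ β) {f f₁ : ℝ → ℂ} :
    JumpCondition β t f f₁ ↔ ∃ fm fp dm dp : ℂ,
      Tendsto f (𝓝[<] t) (𝓝 fm) ∧ Tendsto f (𝓝[>] t) (𝓝 fp) ∧
      Tendsto f₁ (𝓝[<] t) (𝓝 dm) ∧ Tendsto f₁ (𝓝[>] t) (𝓝 dp) ∧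
      ((β - 1 : ℝ) : ℂ) * fp = ((β + 1 : ℝ) : ℂ) * fm ∧
      ((β + 1 : ℝ) : ℂ) * dp = ((β - 1 : ℝ) : ℂ) * dm := by
  have key : ∀ fm fp dm dp : ℂ,
      ((β ≠ 1 → fp = (√(branching β) : ℂ) * fm ∧ dp = 1 / (√(branching β) : ℂ) * dm) ∧
        (β = 1 → fm = 0 ∧ dp = 0)) ↔
      ((β - 1 : ℝ) : ℂ) * fp = ((β + 1 : ℝ) : ℂ) * fm ∧
      ((β + 1 : ℝ) : ℂ) * dp = ((β - 1 : ℝ) : ℂ) * dm := by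
    intro fm fp dm dp
    rcases hβ.eq_or_lt with h | h
    · subst h
      norm_num
    · have h0 : 0 < β - 1 := by linarith
      have h1 : √(branching β) = (β + 1) / (β - 1) :=
        Real.sqrt_sq (div_nonneg (by linarith) h0.le)
      have h2 : ((β - 1 : ℝ) : ℂ) ≠ 0 := Complex.ofReal_ne_zero.2 h0.ne'
      have h3 : ((β + 1 : ℝ) : ℂ) ≠ 0 := Complex.ofReal_ne_zero.2 (by linarith)
      simp only [ne_eq, h.ne', not_false_eq_true, forall_const, IsEmpty.forall_iff, and_true, h1,
        Complex.ofReal_div]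
      generalize ((β - 1 : ℝ) : ℂ) = x at *
      generalize ((β + 1 : ℝ) : ℂ) = y at *
      refine and_congr ?_ ?_
      · rw [div_mul_eq_mul_div, eq_div_iff h2, mul_comm]
      · rw [one_div_div, div_mul_eq_mul_div, eq_div_iff h3, mul_comm]
  unfold JumpCondition
  simp only [key]

/-- The properties of the support and the atoms of `μ` on which the operator depends: the points of
the support are `ε`-separated and lie in `[ε, ∞)`, and the atoms have mass at least `1`. -/
structure IsSeparated (ε : ℝ) (μ : Measure ℝ) : Prop where
  pos : 0 < ε
  separated : ∀ s ∈ μ.support, ∀ t ∈ μ.support, s ≠ t → ε ≤ |s - t|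
  le : ∀ t ∈ μ.support, ε ≤ t
  one_le : ∀ t ∈ μ.support, 1 ≤ μ.real {t}

section

variable {ε : ℝ} {μ : Measure ℝ}

lemma IsSeparated.le_abs_sub (h : IsSeparated ε μ) {s t : ℝ} (hs : s ∈ insert 0 μ.support)
    (ht : t ∈ insert 0 μ.support) (hst : s ≠ t) : ε ≤ |s - t| := by
  rcases hs with rfl | hs <;> rcases ht with rfl | ht
  · exact absurd rfl hst
  · rw [zero_sub, abs_neg]
    exact (h.le t ht).trans (le_abs_self t)
  · rw [sub_zero]
    exact (h.le s hs).trans (le_abs_self s)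
  · exact h.separated s hs t ht hst

open Classical in
/-- The jump data on the whole line attached to `μ`. The condition
`f(t+) = √b f(t-)` reads `(β - 1) f(t+) = (β + 1) f(t-)`, which includes `β = 1`. The point `0` is
added with the condition `f(0+) = 0`, which decouples the two half-lines. -/
def IsSeparated.jumpData (h : IsSeparated ε μ) : JumpData where
  S := insert 0 μ.support
  km t := if t = 0 then 0 else if t ∈ μ.support then μ.real {t} + 1 else 1
  kp t := if t = 0 then 1 else if t ∈ μ.support then μ.real {t} - 1 else 1
  isolated t := by
    -- two distinct points of `[t - ε / 3, t + ε / 3]` are too close to each other; if the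
    -- interval contains one point other than `t`, it is shortened
    by_cases hex : ∃ s ∈ Icc (t - ε / 3) (t + ε / 3) ∩ insert 0 μ.support, s ≠ t
    · obtain ⟨s, ⟨hsI, hs⟩, hst⟩ := hex
      have hpos : 0 < |s - t| := abs_pos.2 (sub_ne_zero.2 hst)
      have hle : |s - t| ≤ ε / 3 := abs_le.2 ⟨by linarith [hsI.1], by linarith [hsI.2]⟩
      refine ⟨|s - t| / 2, by linarith, fun x hx => ?_⟩
      have hxt : |x - t| ≤ |s - t| / 2 := abs_le.2 ⟨by linarith [hx.1.1], by linarith [hx.1.2]⟩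
      by_contra hne
      have hxs : x ≠ s := fun hxs => by rw [hxs] at hxt; linarith
      have h1 := h.le_abs_sub hx.2 hs hxs
      have h2 := abs_sub_le x t s
      rw [abs_sub_comm t s] at h2
      linarith [h.pos]
    · push Not at hex
      exact ⟨ε / 3, by linarith [h.pos], fun x hx => hex x hx⟩
  ne_zero t := by
    split_ifs with h0 ht
    · exact Or.inr one_ne_zero
    · exact Or.inl (by linarith [h.one_le t ht])
    · exact Or.inl one_ne_zero
  off t ht := by
    rw [mem_insert_iff, not_or] at ht
    simp [ht.1, ht.2]

lemma IsSeparated.pos_of_mem (h : IsSeparated ε μ) {t : ℝ} (ht : t ∈ μ.support) : 0 < t :=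
  h.pos.trans_le (h.le t ht)

lemma IsSeparated.km_zero (h : IsSeparated ε μ) : h.jumpData.km 0 = 0 := by
  simp [jumpData]

lemma IsSeparated.kp_zero (h : IsSeparated ε μ) : h.jumpData.kp 0 = 1 := by
  simp [jumpData]

lemma IsSeparated.km_eq (h : IsSeparated ε μ) {t : ℝ} (ht : t ∈ μ.support) :
    h.jumpData.km t = μ.real {t} + 1 := by
  simp [jumpData, ht, (h.pos_of_mem ht).ne']

lemma IsSeparated.kp_eq (h : IsSeparated ε μ) {t : ℝ} (ht : t ∈ μ.support) :
    h.jumpData.kp t = μ.real {t} - 1 := by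
  simp [jumpData, ht, (h.pos_of_mem ht).ne']

lemma IsSeparated.volume_support (h : IsSeparated ε μ) : volume μ.support = 0 :=
  measure_mono_null (subset_insert _ _) h.jumpData.volume_S

lemma IsSeparated.restrict_regularSet (h : IsSeparated ε μ) :
    (volume : Measure ℝ).restrict (regularSet μ) = volume.restrict (Ioi 0) :=
  Measure.restrict_congr_set (sdiff_null_ae_eq_self h.volume_support)

lemma IsDerivOn.indicator_Ioi {S : Set ℝ} {f g : ℝ → ℂ} (h : IsDerivOn (Ioi 0 \ S) f g) :
    IsDerivOn (insert 0 S)ᶜ ((Ioi 0).indicator f) ((Ioi 0).indicator g) := by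
  intro a b hab hU
  rcases lt_or_ge 0 a with ha | ha
  · have hI : Icc a b ⊆ Ioi 0 := fun x hx => ha.trans_le hx.1
    obtain ⟨h1, h2⟩ := h a b hab fun x hx => ⟨hI hx, fun hxS => hU hx (Or.inr hxS)⟩
    have e : EqOn ((Ioi 0).indicator g) g (uIcc a b) := by
      rw [uIcc_of_le hab]
      exact fun x hx => indicator_of_mem (hI hx) g
    refine ⟨IntervalIntegrable.congr (e.symm.mono uIoc_subset_uIcc) h1, ?_⟩
    rw [intervalIntegral.integral_congr e, ← h2, indicator_of_mem (hI (left_mem_Icc.2 hab)),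
      indicator_of_mem (hI (right_mem_Icc.2 hab))]
  · have hb : b < 0 := lt_of_not_ge fun hb => hU ⟨ha, hb⟩ (Or.inl rfl)
    have hI : ∀ x ∈ Icc a b, x ∉ Ioi (0 : ℝ) := fun x hx =>
      not_lt.2 (hx.2.trans hb.le)
    have e : EqOn ((Ioi 0).indicator g) 0 (uIcc a b) := by
      rw [uIcc_of_le hab]
      exact fun x hx => indicator_of_notMem (hI x hx) g
    refine ⟨IntervalIntegrable.congr (e.symm.mono uIoc_subset_uIcc)
      (intervalIntegrable_const (c := (0 : ℂ))), ?_⟩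
    rw [intervalIntegral.integral_congr e, indicator_of_notMem (hI a (left_mem_Icc.2 hab)),
      indicator_of_notMem (hI b (right_mem_Icc.2 hab))]
    simp

lemma tendsto_indicator_Ioi_zero_left (f : ℝ → ℂ) :
    Tendsto ((Ioi 0).indicator f) (𝓝[<] 0) (𝓝 0) := by
  refine tendsto_const_nhds.congr' ?_
  filter_upwards [self_mem_nhdsWithin] with x hx
  exact (indicator_of_notMem (not_lt.2 (le_of_lt hx)) f).symm

lemma tendsto_indicator_Ioi_of_pos {f : ℝ → ℂ} {l : Filter ℝ} (hl : Ioi (0 : ℝ) ∈ l)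
    {z : ℂ} (h : Tendsto f l (𝓝 z)) : Tendsto ((Ioi 0).indicator f) l (𝓝 z) := by
  refine h.congr' ?_
  filter_upwards [hl] with x hx using (indicator_of_mem hx f).symm

/-- Extending an operator pair by zero to `ℝ` gives a first-order system with the jump conditions of
`μ`. -/
lemma IsSeparated.solve_eq_of_isOperatorPair (h : IsSeparated ε μ) {u w : L2Half}
    (huw : IsOperatorPair μ u w) :
    h.jumpData.solve (restrictHalf.adjoint (u + w)) = restrictHalf.adjoint u := by
  obtain ⟨f, f₁, f₂, hu, hw, hH2, h0, hjump⟩ := huw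
  have hmem : ∀ {p : ℝ → ℂ}, MemLp p 2 (volume.restrict (regularSet μ)) →
      MemLp ((Ioi 0).indicator p) 2 volume := fun hp => by
    rw [h.restrict_regularSet] at hp
    exact (memLp_indicator_iff_restrict measurableSet_Ioi).2 hp
  have hlr : ∀ t ∈ μ.support, Ioi (0 : ℝ) ∈ 𝓝[<] t ∧ Ioi (0 : ℝ) ∈ 𝓝[>] t := fun t ht =>
    ⟨mem_nhdsWithin_of_mem_nhds (Ioi_mem_nhds (h.pos_of_mem ht)),
      mem_nhdsWithin_of_mem_nhds (Ioi_mem_nhds (h.pos_of_mem ht))⟩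
  have hF : IsFirstOrderPair h.jumpData ((Ioi 0).indicator f) ((Ioi 0).indicator f₁) := by
    refine ⟨hmem hH2.memLp, hmem hH2.memLp_deriv, hH2.deriv.indicator_Ioi, ?_⟩
    rintro t (rfl | ht)
    · refine ⟨0, 0, tendsto_indicator_Ioi_zero_left f,
        tendsto_indicator_Ioi_of_pos self_mem_nhdsWithin h0, by simp⟩
    · obtain ⟨fm, fp, dm, dp, k1, k2, k3, k4, k5, k6⟩ :=
        (jumpCondition_iff (h.one_le t ht)).1 (hjump t ht)
      refine ⟨fm, fp, tendsto_indicator_Ioi_of_pos (hlr t ht).1 k1,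
        tendsto_indicator_Ioi_of_pos (hlr t ht).2 k2, ?_⟩
      rw [h.km_eq ht, h.kp_eq ht, k5]
  have hG : IsFirstOrderPair h.jumpData.swap ((Ioi 0).indicator f₁) ((Ioi 0).indicator f₂) := by
    refine ⟨hmem hH2.memLp_deriv, hmem hH2.memLp_deriv2, hH2.deriv2.indicator_Ioi, ?_⟩
    rintro t (rfl | ht)
    · have hsub : Ioo 0 ε ⊆ regularSet μ := fun x hx =>
        ⟨hx.1, fun hxS => absurd hx.2 (not_lt.2 (h.le x hxS))⟩
      have hint : IntegrableOn f₂ (Ioo 0 ε) :=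
        (hH2.memLp_deriv2.mono_measure (Measure.restrict_mono_set _ hsub)).integrable one_le_two
      obtain ⟨l, hl⟩ := (hH2.deriv2.mono hsub).exists_tendsto_right h.pos hint
      refine ⟨0, l, tendsto_indicator_Ioi_zero_left f₁,
        tendsto_indicator_Ioi_of_pos self_mem_nhdsWithin hl, ?_⟩
      change (h.jumpData.km 0 : ℂ) * l = h.jumpData.kp 0 * 0
      rw [h.km_zero]
      simp
    · obtain ⟨fm, fp, dm, dp, k1, k2, k3, k4, k5, k6⟩ :=
        (jumpCondition_iff (h.one_le t ht)).1 (hjump t ht)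
      refine ⟨dm, dp, tendsto_indicator_Ioi_of_pos (hlr t ht).1 k3,
        tendsto_indicator_Ioi_of_pos (hlr t ht).2 k4, ?_⟩
      change (h.jumpData.km t : ℂ) * dp = h.jumpData.kp t * dm
      rw [h.km_eq ht, h.kp_eq ht, k6]
  refine (h.jumpData.solve_eq_iff _ _).2 ⟨_, _, ?_, hF, hG.congr_deriv ?_⟩
  · filter_upwards [adjoint_restrictHalf_coeFn u,
      (ae_restrict_iff' measurableSet_Ioi).1 hu] with x hx1 hx2
    rw [hx1]
    by_cases hx : x ∈ Ioi (0 : ℝ)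
    · rw [indicator_of_mem hx, indicator_of_mem hx, hx2 hx]
    · rw [indicator_of_notMem hx, indicator_of_notMem hx]
  · have e : restrictHalf.adjoint u - restrictHalf.adjoint (u + w) = -restrictHalf.adjoint w := by
      rw [map_add]; abel
    rw [e]
    filter_upwards [Lp.coeFn_neg (restrictHalf.adjoint w), adjoint_restrictHalf_coeFn w,
      (ae_restrict_iff' measurableSet_Ioi).1 hw] with x hx1 hx2 hx3
    rw [hx1, Pi.neg_apply, hx2]
    by_cases hx : x ∈ Ioi (0 : ℝ)
    · rw [indicator_of_mem hx, indicator_of_mem hx, hx3 hx, neg_neg]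
    · rw [indicator_of_notMem hx, indicator_of_notMem hx, neg_zero]

/-- A solution on `ℝ` restricts to an operator pair on `(0, ∞)`. -/
lemma IsSeparated.isOperatorPair_of_solve_eq (h : IsSeparated ε μ) {u w : L2Half}
    (huw : restrictHalf (h.jumpData.solve (restrictHalf.adjoint (u + w))) = u) :
    IsOperatorPair μ u w := by
  set U : L2Line := h.jumpData.solve (restrictHalf.adjoint (u + w)) with hU
  obtain ⟨f, f₁, hfU, hf, hf1⟩ := (h.jumpData.solve_eq_iff U _).1 hU.symm
  set f₂ : ℝ → ℂ := ⇑(U - restrictHalf.adjoint (u + w)) with hf2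
  have hsub : regularSet μ ⊆ h.jumpData.Sᶜ := by
    rintro x ⟨hx0, hx⟩ (rfl | hxS)
    · exact lt_irrefl (0 : ℝ) hx0
    · exact hx hxS
  have hUu : u =ᵐ[volume.restrict (Ioi 0)] U := by
    conv_lhs => rw [← huw]
    exact restrictHalf_coeFn U
  refine ⟨f, f₁, f₂, hUu.trans (ae_restrict_of_ae hfU.symm), ?_,
    ⟨hf.memLp.restrict _, hf1.memLp.restrict _, hf1.memLp_deriv.restrict _,
      hf.deriv.mono hsub, hf1.deriv.mono hsub⟩, ?_, fun t ht => ?_⟩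
  · filter_upwards [hUu, Lp.coeFn_add u w,
      ae_restrict_of_ae (s := Ioi 0) (Lp.coeFn_sub U (restrictHalf.adjoint (u + w))),
      ae_restrict_of_ae (s := Ioi 0) (adjoint_restrictHalf_coeFn (u + w)),
      ae_restrict_mem measurableSet_Ioi] with x h1 h2 h3 h4 h5
    rw [hf2, h3, Pi.sub_apply, h4, indicator_of_mem h5, h2, Pi.add_apply, ← h1]
    ring
  · obtain ⟨fm, fp, k1, k2, k3⟩ := hf.jump 0 (Or.inl rfl)
    rw [h.km_zero, h.kp_zero] at k3
    have : fp = 0 := by simpa using k3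
    rwa [this] at k2
  · obtain ⟨fm, fp, k1, k2, k3⟩ := hf.jump t (Or.inr ht)
    obtain ⟨dm, dp, l1, l2, l3⟩ := hf1.jump t (Or.inr ht)
    change (h.jumpData.km t : ℂ) * dp = h.jumpData.kp t * dm at l3
    rw [h.km_eq ht, h.kp_eq ht] at k3 l3
    exact (jumpCondition_iff (h.one_le t ht)).2 ⟨fm, fp, dm, dp, k1, k2, l1, l2, k3, l3⟩

/-- The inverse of `A⁺_μ + 1`. -/
def IsSeparated.inverse (h : IsSeparated ε μ) : L2Half →L[ℂ] L2Half :=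
  restrictHalf ∘L h.jumpData.solve ∘L restrictHalf.adjoint

lemma IsSeparated.isSelfAdjoint_inverse (h : IsSeparated ε μ) : IsSelfAdjoint h.inverse :=
  h.jumpData.isSelfAdjoint_solve.conj_adjoint restrictHalf

/-- The graph of `A⁺_μ` is determined by `inverse`: one inclusion is the restriction of solutions
from `ℝ`, the other the uniqueness of the solution applied to the extension by zero. -/
theorem IsSeparated.isShiftedInverse (h : IsSeparated ε μ) :
    IsShiftedInverse (halfLineOperator μ) h.inverse := by
  intro u w
  rw [halfLineOperator, Submodule.toLinearPMap_graph_eq _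
    (operatorGraph_singleValued h.volume_support)]
  refine ⟨fun huw => ?_, h.isOperatorPair_of_solve_eq⟩
  change restrictHalf (h.jumpData.solve (restrictHalf.adjoint (u + w))) = u
  rw [h.solve_eq_of_isOperatorPair huw, restrictHalf_adjoint]

end

/-! ### Weak limits of separated atomic measures -/

section

variable {ε : ℝ} {μ : Measure ℝ}

lemma isSeparated_of_mem (hε : 0 < ε) (hμ : μ ∈ AtomicMeasuresPos ε) : IsSeparated ε μ := by
  obtain ⟨⟨S, β, hβ, hS, rfl⟩, hsupp⟩ := hμ
  set μ : Measure ℝ := Measure.sum fun t : S => ENNReal.ofReal (β t) • Measure.dirac (t : ℝ)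
  have hclosed : IsClosed S :=
    Metric.isClosed_of_pairwise_le_dist hε fun s hs t ht hst => hS s hs t ht hst
  have hsub : μ.support ⊆ S := by
    refine Measure.support_subset_of_isClosed hclosed ?_
    rw [mem_ae_iff, Measure.sum_apply _ hclosed.measurableSet.compl]
    simp [Measure.dirac_apply' _ hclosed.measurableSet.compl]
  have hatom : ∀ t ∈ S, μ.real {t} = β t := by
    intro t ht
    rw [measureReal_def, Measure.sum_apply _ (measurableSet_singleton t),
      tsum_eq_single (⟨t, ht⟩ : S)]
    · simp [ENNReal.toReal_ofReal (zero_le_one.trans (hβ t ht))]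
    · rintro ⟨s, hs⟩ hst
      have : s ≠ t := fun h => hst (Subtype.ext h)
      simp [this]
  exact ⟨hε, fun s hs t ht hst => hS s (hsub hs) t (hsub ht) hst, fun t ht => hsupp ht,
    fun t ht => (hatom t (hsub ht)).symm ▸ hβ t (hsub ht)⟩

lemma IsSeparated.mem_atomicMeasuresPos (h : IsSeparated ε μ) : μ ∈ AtomicMeasuresPos ε := by
  refine ⟨⟨μ.support, fun t => μ.real {t}, h.one_le, h.separated, ?_⟩, fun t ht => h.le t ht⟩
  have hdisc : DiscreteTopology μ.support := DiscreteTopology.of_forall_le_dist h.pos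
    fun s t hst => h.separated s s.2 t t.2 fun h => hst (Subtype.ext h)
  have hcount : Countable μ.support := countable_of_Lindelof_of_discrete
  have h1 : μ.restrict μ.support = μ := Measure.restrict_eq_self_of_ae_mem Measure.support_mem_ae
  have h2 : ⋃ t : μ.support, ({(t : ℝ)} : Set ℝ) = μ.support := iUnion_of_singleton_coe _
  conv_lhs => rw [← h1, ← h2]
  rw [Measure.restrict_iUnion
    (fun s t hst => disjoint_singleton.2 fun h => hst (Subtype.ext h))
    fun t => measurableSet_singleton _]
  congr 1
  ext1 t
  simp only [Measure.restrict_singleton]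
  rw [measureReal_def, ENNReal.ofReal_toReal]
  -- an infinite atom would have real mass `0`
  intro htop
  have := h.one_le t t.2
  rw [measureReal_def, htop] at this
  norm_num at this

/-- A function that vanishes at all points of the support except `t` integrates to its value at `t`
times the mass of `t`. -/
lemma integral_eq_of_support_subset {φ : ℝ → ℝ} {t : ℝ}
    (hφ : ∀ s ∈ μ.support, s ≠ t → φ s = 0) : ∫ x, φ x ∂μ = μ.real {t} * φ t := by
  have h1 : φ =ᵐ[μ] ({t} : Set ℝ).indicator φ := by
    filter_upwards [(Measure.support_mem_ae : μ.support ∈ ae μ)] with s hs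
    by_cases hst : s = t
    · rw [indicator_of_mem (by simpa using hst)]
    · rw [indicator_of_notMem (by simpa using hst), hφ s hs hst]
  rw [integral_congr_ae h1, integral_indicator (measurableSet_singleton t), integral_singleton,
    smul_eq_mul]

lemma integral_eq_zero_of_forall_support {φ : ℝ → ℝ} (hφ : ∀ s ∈ μ.support, φ s = 0) :
    ∫ x, φ x ∂μ = 0 := by
  refine integral_eq_zero_of_ae ?_
  filter_upwards [(Measure.support_mem_ae : μ.support ∈ ae μ)] with s hs using hφ s hs

/-- Points of the support closer to each other than `ε` coincide. -/
lemma IsSeparated.eq_of_dist_lt (h : IsSeparated ε μ) {s t : ℝ} (hs : s ∈ μ.support)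
    (ht : t ∈ μ.support) (hst : dist s t < ε) : s = t := by
  by_contra hne
  exact absurd hst (not_lt.2 (h.separated s hs t ht hne))

end

section

variable {ε : ℝ} {μs : ℕ → Measure ℝ} {μ : Measure ℝ}

lemma WeaklyConverges.tendsto_bump (hconv : WeaklyConverges μs μ) {t : ℝ} (φ : ContDiffBump t) :
    Tendsto (fun j => ∫ x, φ x ∂(μs j)) atTop (𝓝 (∫ x, φ x ∂μ)) :=
  hconv φ φ.continuous φ.hasCompactSupport

/-- Near each point of the support of a weak limit the approximating measures eventually have
mass. -/
lemma WeaklyConverges.eventually_exists_near [IsLocallyFiniteMeasure μ]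
    (hconv : WeaklyConverges μs μ) {t : ℝ} (ht : t ∈ μ.support) {r : ℝ} (hr : 0 < r) :
    ∀ᶠ j in atTop, ∃ s ∈ (μs j).support, dist s t < r := by
  let φ : ContDiffBump t := ⟨r / 2, r, by linarith, by linarith⟩
  have hpos : 0 < ∫ x, φ x ∂μ := by
    rw [integral_pos_iff_support_of_nonneg (fun x => φ.nonneg)
      (φ.continuous.integrable_of_hasCompactSupport φ.hasCompactSupport), φ.support_eq]
    exact (Measure.mem_support_iff_forall t).1 ht _ (Metric.ball_mem_nhds t hr)
  filter_upwards [(hconv.tendsto_bump φ).eventually (lt_mem_nhds hpos)] with j hj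
  by_contra! hno
  have hzero : ∫ x, φ x ∂(μs j) = 0 :=
    integral_eq_zero_of_forall_support fun s hs => φ.zero_of_le_dist (hno s hs)
  linarith

/-- Each point of the support of a weak limit is the limit of points of the supports. -/
lemma WeaklyConverges.exists_tendsto [IsLocallyFiniteMeasure μ]
    (hμs : ∀ j, IsSeparated ε (μs j)) (hconv : WeaklyConverges μs μ) {t : ℝ}
    (ht : t ∈ μ.support) :
    ∃ τ : ℕ → ℝ, Tendsto τ atTop (𝓝 t) ∧ ∀ᶠ j in atTop, τ j ∈ (μs j).support := by
  classical
  have hε : 0 < ε / 4 := by linarith [(hμs 0).pos]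
  set τ : ℕ → ℝ := fun j =>
    if h : ∃ s ∈ (μs j).support, dist s t < ε / 4 then h.choose else t with hτ
  have hspec : ∀ j, (∃ s ∈ (μs j).support, dist s t < ε / 4) →
      τ j ∈ (μs j).support ∧ dist (τ j) t < ε / 4 := by
    intro j hj
    simp only [hτ, dif_pos hj]
    exact hj.choose_spec
  refine ⟨τ, Metric.tendsto_nhds.2 fun δ hδ => ?_, ?_⟩
  · filter_upwards [hconv.eventually_exists_near ht (lt_min hδ hε)] with j ⟨s, hs, hst⟩
    obtain ⟨h1, h2⟩ := hspec j ⟨s, hs, hst.trans_le (min_le_right _ _)⟩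
    have h3 : dist (τ j) s < ε := by
      have h4 := dist_triangle_right (τ j) s t
      have h5 := hst.trans_le (min_le_right _ _)
      linarith
    rw [(hμs j).eq_of_dist_lt h1 hs h3]
    exact hst.trans_le (min_le_left _ _)
  · filter_upwards [hconv.eventually_exists_near ht hε] with j hj using (hspec j hj).1

/-- The masses of the approximating atoms converge. -/
lemma WeaklyConverges.tendsto_atom (hμs : ∀ j, IsSeparated ε (μs j))
    (hconv : WeaklyConverges μs μ)
    (hsep : ∀ s ∈ μ.support, ∀ t ∈ μ.support, s ≠ t → ε ≤ |s - t|) {t : ℝ}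
    (ht : t ∈ μ.support) {τ : ℕ → ℝ} (hτ : Tendsto τ atTop (𝓝 t))
    (hτs : ∀ᶠ j in atTop, τ j ∈ (μs j).support) :
    Tendsto (fun j => (μs j).real {τ j}) atTop (𝓝 (μ.real {t})) := by
  have hε := (hμs 0).pos
  let φ : ContDiffBump t := ⟨ε / 8, ε / 4, by linarith, by linarith⟩
  have h1 : ∫ x, φ x ∂μ = μ.real {t} := by
    rw [integral_eq_of_support_subset (t := t), φ.one_of_mem_closedBall, mul_one]
    · exact Metric.mem_closedBall_self (by positivity : 0 ≤ ε / 8)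
    · intro s hs hst
      refine φ.zero_of_le_dist ?_
      have : ε ≤ dist s t := hsep s hs t ht hst
      change ε / 4 ≤ dist s t
      linarith
  have h2 : ∀ᶠ j in atTop, ∫ x, φ x ∂(μs j) = (μs j).real {τ j} := by
    filter_upwards [hτs, hτ.eventually (Metric.closedBall_mem_nhds t (by linarith : 0 < ε / 8))]
      with j hj hj'
    rw [integral_eq_of_support_subset (t := τ j), φ.one_of_mem_closedBall hj', mul_one]
    intro s hs hst
    refine φ.zero_of_le_dist ?_
    have h3 : ε ≤ dist s (τ j) := (hμs j).separated s hs _ hj hst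
    have h4 : dist (τ j) t ≤ ε / 8 := hj'
    have h5 := dist_triangle_right s (τ j) t
    change ε / 4 ≤ dist s t
    linarith
  have h3 := hconv.tendsto_bump φ
  rw [h1] at h3
  exact h3.congr' h2

/-- The separation of the atoms and the lower bound on their masses pass to weak limits. -/
theorem WeaklyConverges.isSeparated [IsLocallyFiniteMeasure μ]
    (hμs : ∀ j, IsSeparated ε (μs j)) (hconv : WeaklyConverges μs μ) : IsSeparated ε μ := by
  have hε := (hμs 0).pos
  have hsep : ∀ s ∈ μ.support, ∀ t ∈ μ.support, s ≠ t → ε ≤ |s - t| := by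
    intro s hs t ht hst
    obtain ⟨σ, hσ, hσs⟩ := hconv.exists_tendsto hμs hs
    obtain ⟨τ, hτ, hτs⟩ := hconv.exists_tendsto hμs ht
    refine ge_of_tendsto (hσ.sub hτ).abs ?_
    filter_upwards [hσs, hτs, (hσ.sub hτ).eventually_ne (sub_ne_zero.2 hst)] with j h1 h2 h3
    exact (hμs j).separated _ h1 _ h2 (sub_ne_zero.1 h3)
  refine ⟨hε, hsep, fun t ht => ?_, fun t ht => ?_⟩
  · obtain ⟨τ, hτ, hτs⟩ := hconv.exists_tendsto hμs ht
    exact ge_of_tendsto hτ (hτs.mono fun j hj => (hμs j).le _ hj)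
  · obtain ⟨τ, hτ, hτs⟩ := hconv.exists_tendsto hμs ht
    exact ge_of_tendsto (hconv.tendsto_atom hμs hsep ht hτ hτs)
      (hτs.mono fun j hj => (hμs j).one_le _ hj)

/-- A compact set without mass in the limit eventually carries no mass at all, since the atoms have
mass at least `1`. -/
lemma WeaklyConverges.eventually_disjoint (hμs : ∀ j, IsSeparated ε (μs j))
    (hconv : WeaklyConverges μs μ) {K : Set ℝ} (hK : IsCompact K)
    (hdisj : ∀ x ∈ K, x ∉ μ.support) : ∀ᶠ j in atTop, ∀ x ∈ K, x ∉ (μs j).support := by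
  have hε := (hμs 0).pos
  refine hK.induction_on (p := fun s => ∀ᶠ j in atTop, ∀ x ∈ s, x ∉ (μs j).support)
    (by simp) (fun s t hst ht => ht.mono fun j hj x hx => hj x (hst hx))
    (fun s t hs ht => ?_) fun x hx => ?_
  · filter_upwards [hs, ht] with j h1 h2 y hy
    exact hy.elim (h1 y) (h2 y)
  · obtain ⟨ρ, hρ, hball⟩ := Metric.isOpen_iff.1 μ.isOpen_compl_support x (hdisj x hx)
    have hr : 0 < min ρ (ε / 4) := lt_min hρ (by linarith)
    let φ : ContDiffBump x := ⟨min ρ (ε / 4) / 2, min ρ (ε / 4), by linarith, by linarith⟩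
    have h1 : ∫ y, φ y ∂μ = 0 := integral_eq_zero_of_forall_support fun s hs => by
      refine φ.zero_of_le_dist (not_lt.1 fun hlt => ?_)
      exact hball (Metric.mem_ball.2 (hlt.trans_le (min_le_left _ _))) hs
    have h2 := hconv.tendsto_bump φ
    rw [h1] at h2
    refine ⟨_, mem_nhdsWithin_of_mem_nhds (Metric.closedBall_mem_nhds x (half_pos hr)), ?_⟩
    filter_upwards [h2.eventually (gt_mem_nhds zero_lt_one)] with j hj s hs hsupp
    rw [integral_eq_of_support_subset (t := s), φ.one_of_mem_closedBall hs, mul_one] at hj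
    · linarith [(hμs j).one_le s hsupp]
    · intro y hy hys
      refine φ.zero_of_le_dist ?_
      have h3 : ε ≤ dist y s := (hμs j).separated y hy s hsupp hys
      have h4 : dist s x ≤ min ρ (ε / 4) / 2 := hs
      have h5 := dist_triangle_right y s x
      have h6 := min_le_right ρ (ε / 4)
      change min ρ (ε / 4) ≤ dist y x
      linarith

/-- Weak convergence of the measures implies convergence of the jump data. -/
theorem WeaklyConverges.converges_jumpData [IsLocallyFiniteMeasure μ]
    (hμs : ∀ j, IsSeparated ε (μs j)) (hconv : WeaklyConverges μs μ) (hμ : IsSeparated ε μ) :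
    JumpData.Converges (fun j => (hμs j).jumpData) hμ.jumpData := by
  rintro c t d ⟨hct, htd, hw⟩
  have hmem : ∀ x ∈ Icc c d, x ∈ insert 0 μ.support → x = t := fun x hx hxS => hw ⟨hx, hxS⟩
  have htI : t ∈ Icc c d := ⟨hct.le, htd.le⟩
  by_cases ht : t ∈ μ.support
  · have h0 : (0 : ℝ) ∉ Icc c d := fun h =>
      (hμ.pos_of_mem ht).ne (hmem 0 h (Or.inl rfl))
    obtain ⟨τ, hτ, hτs⟩ := hconv.exists_tendsto hμs ht
    have hatom := hconv.tendsto_atom hμs hμ.separated ht hτ hτs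
    have hε : 0 < ε / 4 := by linarith [hμ.pos]
    refine ⟨τ, hτ, ?_, ?_, ?_⟩
    · have hK : IsCompact (Icc c d \ Metric.ball t (ε / 4)) := isCompact_Icc.diff Metric.isOpen_ball
      filter_upwards [hτs, hτ.eventually (Metric.ball_mem_nhds t hε),
        hconv.eventually_disjoint hμs hK fun x hx hxS =>
          hx.2 (hmem x hx.1 (Or.inr hxS) ▸ Metric.mem_ball_self hε)] with j h1 h2 h3 x hx
      rcases hx.2 with rfl | hxS
      · exact absurd hx.1 h0
      · have hxb : x ∈ Metric.ball t (ε / 4) := by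
          by_contra hxb
          exact h3 x ⟨hx.1, hxb⟩ hxS
        refine (hμs j).eq_of_dist_lt hxS h1 ?_
        have := dist_triangle_right x (τ j) t
        rw [Metric.mem_ball] at hxb
        linarith
    · rw [hμ.km_eq ht]
      refine (hatom.add_const 1).congr' ?_
      filter_upwards [hτs] with j hj using ((hμs j).km_eq hj).symm
    · rw [hμ.kp_eq ht]
      refine (hatom.sub_const 1).congr' ?_
      filter_upwards [hτs] with j hj using ((hμs j).kp_eq hj).symm
  · have hno : ∀ x ∈ Icc c d, x ∉ μ.support := fun x hx hxS =>
      ht (hmem x hx (Or.inr hxS) ▸ hxS)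
    have hev := hconv.eventually_disjoint hμs isCompact_Icc hno
    refine ⟨fun _ => t, tendsto_const_nhds, ?_, ?_⟩
    · filter_upwards [hev] with j hj x hx
      rcases hx.2 with rfl | hxS
      · exact hmem 0 hx.1 (Or.inl rfl)
      · exact absurd hxS (hj x hx.1)
    · by_cases ht0 : t = 0
      · subst ht0
        simp only [IsSeparated.km_zero, IsSeparated.kp_zero]
        exact ⟨tendsto_const_nhds, tendsto_const_nhds⟩
      · have hoff := hμ.jumpData.off t fun h => h.elim ht0 ht
        have hoffj : ∀ᶠ j in atTop, (hμs j).jumpData.km t = 1 ∧ (hμs j).jumpData.kp t = 1 := by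
          filter_upwards [hev] with j hj
          exact (hμs j).jumpData.off t fun h => h.elim ht0 (hj t htI)
        rw [hoff.1, hoff.2]
        exact ⟨tendsto_const_nhds.congr' (hoffj.mono fun j hj => hj.1.symm),
          tendsto_const_nhds.congr' (hoffj.mono fun j hj => hj.2.symm)⟩

end

end HalfLine

end

theorem mainTheorem8 (ε : ℝ) (hε : 0 < ε) (μs : ℕ → Measure ℝ)
    (hμs : ∀ j, μs j ∈ HalfLine.AtomicMeasuresPos ε)
    (μ : Measure ℝ) [IsLocallyFiniteMeasure μ]
    (hconv : HalfLine.WeaklyConverges μs μ) :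
    μ ∈ HalfLine.AtomicMeasuresPos ε ∧
      HalfLine.StrongResolventConverges
        (fun j => HalfLine.halfLineOperator (μs j)) (HalfLine.halfLineOperator μ) := by
  have hs := fun j => HalfLine.isSeparated_of_mem hε (hμs j)
  have hμ := hconv.isSeparated hs
  refine ⟨hμ.mem_atomicMeasuresPos,
    HalfLine.strongResolventConverges_of_isShiftedInverse (fun j => (hs j).isSelfAdjoint_inverse)
      hμ.isSelfAdjoint_inverse (fun j => (hs j).isShiftedInverse) hμ.isShiftedInverse fun v => ?_⟩
  exact (HalfLine.restrictHalf.continuous.tendsto _).comp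
    ((hconv.converges_jumpData hs hμ).tendsto_solve (HalfLine.restrictHalf.adjoint v))
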